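/- Let $\mathbb F_q$ be a finite field with $q$ elements, $K=\mathbb F_q(\theta)$, $|\cdot|_\infty$ the absolute value of $K$ at infinity with $|\theta|_\infty=q$, $K_\infty=\mathbb F_q((1/\theta))$ its completion, and $\mathbb C_\infty$ the completion of an algebraic closure of $K_\infty$. Fix a $(q-1)$-th root of $-\theta$ in $\mathbb C_\infty$. Let $\mathbb T\subset\mathbb C_\infty[[t]]$ be the Tate algebra of power series converging on $|t|_\infty\le 1$, let $\mathbb T_q$ be the subalgebra of those converging on $|t|_\infty\le q$, write $f^{(1)}=\sum_i a_i^q t^i$ for $f=\sum_i a_it^i$, and put $$\Omega(t)=(-\theta)^{-q/(q-1)}\prod_{i\ge 1}\Bigl(1-\frac{t}{\theta^{q^i}}\Bigr).$$ Let $n\ge 1$. *Continued polylogarithm.* For $Z\in\mathbb T$ let $\overrightarrow{\mathfrak{Li}}_n(Z)\in\mathbb T/\Omega^{-n}\mathbb F_q[t]$ be the class of $\Omega^{-n}g$, where $g\in\mathbb T$ is any solution of $g-g^{(1)}=\Omega^nZ$. A branch is an $\mathbb F_q$-linear lift $\mathbb T\to\mathbb T$ of $\overrightarrow{\mathfrak{Li}}_n$.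 For a map $F$ on $\mathbb T$ put $L(F)(Z)=tF(Z)-F(\theta Z)$. *Tensor power of the Carlitz module.* Let $N$ be the $n\times n$ matrix with ones on the superdiagonal and zeros elsewhere, $E$ the $n\times n$ matrix with a single one in the lower left corner, and $\tau$ the coordinatewise $q$-th power map on $\mathbb C_\infty^n$. Let $\mathrm{Exp}_{C^{\otimes n}}=\sum_{i\ge0}\alpha_i\tau^i$, $\alpha_0=I$, be the unique series with $\mathrm{Exp}_{C^{\otimes n}}\circ(\theta I+N)=(\theta I+N+E\tau)\circ\mathrm{Exp}_{C^{\otimes n}}$, and let $\Lambda_n\subset\mathbb C_\infty^n$ be its kernel, which is stable under $\theta I+N$. *Continued logarithm.* For $f=\sum_{j\ge0}c_j(t-\theta)^j\in\mathbb T_q$ put $\delta_0^n(f)=(c_{n-1},\dots,c_1,c_0)^{\mathtt T}$. Define $\overrightarrow{\mathrm{Log}}_n:\mathbb C_\infty^n\to\mathbb C_\infty^n/\Lambda_n$ by $$\overrightarrow{\mathrm{Log}}_n\bigl((z_1,\dots,z_n)^{\mathtt T}\bigr)=\sum_{k=1}^n\delta_0^n\bigl(L^{n-k}(\overrightarrow{\mathfrak{Li}}_n)(z_k)\bigr)\bmod\Lambda_n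 ,$$ computed with a branch of $\overrightarrow{\mathfrak{Li}}_n$. **Claim.** Branches exist; for every branch $B$ the series $L^i(B)(z)$ ($i\ge 0$, $z\in\mathbb C_\infty$) lie in $\mathbb T_q$; the value $\overrightarrow{\mathrm{Log}}_n(z)$ does not depend on the branch and equals $\delta_0^n\circ\overrightarrow{\mathfrak{Li}}_n\bigl(\sum_{k=1}^n(t-\theta)^{n-k}z_k\bigr)$ modulo $\Lambda_n$. For all $z=(z_1,\dots,z_n)^{\mathtt T}\in\mathbb C_\infty^n$, $$\overrightarrow{\mathrm{Log}}_n\bigl((\theta I+N+E\tau)z\bigr)\equiv(\theta I+N)\,\overrightarrow{\mathrm{Log}}_n(z)\pmod{\Lambda_n}.$$ -/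

import Mathlib

noncomputable section

namespace CarlitzLog

open Filter Topology PowerSeries
open scoped Matrix

variable (Fq : Type*) [Field Fq] [Fintype Fq]

/-! ### The fields `K_∞` and `ℂ_∞` -/

theorem one_lt_card_nnreal : (1 : NNReal) < (Fintype.card Fq : NNReal) := by
  exact_mod_cast Fintype.one_lt_card

open Classical in
/-- The absolute value at infinity on `K = 𝔽_q(θ)`, normalized by `|θ|_∞ = q`. -/
def absInfty : AbsoluteValue (RatFunc Fq) ℝ where
  toFun x := (WithZeroMulInt.toNNReal (one_lt_card_nnreal Fq).ne_zero
    (RatFunc.inftyValuation Fq x) : NNReal)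
  map_mul' x y := by simp
  nonneg' x := NNReal.coe_nonneg _
  eq_zero' x := by simp
  add_le' x y := by
    have hm := (WithZeroMulInt.toNNReal_strictMono (one_lt_card_nnreal Fq)).monotone
    have h := hm ((RatFunc.inftyValuation Fq).map_add x y)
    rw [hm.map_max] at h
    exact_mod_cast h.trans (max_le_add_of_nonneg zero_le zero_le)

theorem absInfty_X : absInfty Fq RatFunc.X = Fintype.card Fq := by
  classical
  have h : absInfty Fq RatFunc.X = (WithZeroMulInt.toNNReal (one_lt_card_nnreal Fq).ne_zero
    (RatFunc.inftyValuation Fq RatFunc.X) : NNReal) := by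
    unfold absInfty; congr!
  rw [h, RatFunc.inftyValuation.X, WithZeroMulInt.toNNReal_neg_apply _ WithZero.exp_ne_zero]
  have : WithZero.unzero (WithZero.exp_ne_zero (a := (1 : ℤ))) = Multiplicative.ofAdd 1 := by
    rw [← WithZero.coe_inj, WithZero.coe_unzero]; rfl
  simp [this]

theorem absInfty_natCast_le_one (n : ℕ) : absInfty Fq n ≤ 1 := by
  classical
  have h : absInfty Fq n = (WithZeroMulInt.toNNReal (one_lt_card_nnreal Fq).ne_zero
    (RatFunc.inftyValuation Fq n) : NNReal) := by
    unfold absInfty; congr!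
  rw [h, ← NNReal.coe_one, NNReal.coe_le_coe,
    WithZeroMulInt.toNNReal_le_one_iff (one_lt_card_nnreal Fq)]
  by_cases hn : (n : Fq) = 0
  · have : (n : RatFunc Fq) = 0 := by
      rw [← map_natCast (RatFunc.C (K := Fq)), hn, map_zero]
    simp [this]
  · rw [← map_natCast (RatFunc.C (K := Fq)), RatFunc.inftyValuation.C Fq hn]

/-- `K_∞ = 𝔽_q((1/θ))`, the completion of `𝔽_q(θ)` at the infinite place. -/
def Kinf : Type _ := (absInfty Fq).Completion

instance : NormedField (Kinf Fq) := inferInstanceAs (NormedField (absInfty Fq).Completion)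
instance : CompleteSpace (Kinf Fq) := inferInstanceAs (CompleteSpace (absInfty Fq).Completion)

/-- The embedding `𝔽_q(θ) → K_∞`. -/
def ofRat : RatFunc Fq →+* Kinf Fq :=
  (UniformSpace.Completion.coeRingHom (α := WithAbs (absInfty Fq))).comp
    (WithAbs.equiv (absInfty Fq)).symm.toRingHom

theorem norm_ofRat (x : RatFunc Fq) : ‖ofRat Fq x‖ = absInfty Fq x :=
  UniformSpace.Completion.norm_coe (E := WithAbs (absInfty Fq)) _

instance : IsUltrametricDist (Kinf Fq) :=
  IsUltrametricDist.isUltrametricDist_of_forall_norm_natCast_le_one fun n => by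
    rw [← map_natCast (ofRat Fq), norm_ofRat]
    exact absInfty_natCast_le_one Fq n

instance : NontriviallyNormedField (Kinf Fq) where
  non_trivial := ⟨ofRat Fq RatFunc.X, by
    rw [norm_ofRat, absInfty_X]
    exact_mod_cast Fintype.one_lt_card⟩

/-- An algebraic closure of `K_∞`, with the unique extension of the absolute value. -/
def KinfBar : Type _ := AlgebraicClosure (Kinf Fq)

instance : Field (KinfBar Fq) := inferInstanceAs (Field (AlgebraicClosure (Kinf Fq)))
instance : Algebra (Kinf Fq) (KinfBar Fq) :=
  inferInstanceAs (Algebra (Kinf Fq) (AlgebraicClosure (Kinf Fq)))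
instance : IsAlgClosure (Kinf Fq) (KinfBar Fq) :=
  inferInstanceAs (IsAlgClosure (Kinf Fq) (AlgebraicClosure (Kinf Fq)))
instance : Algebra.IsAlgebraic (Kinf Fq) (KinfBar Fq) := IsAlgClosure.isAlgebraic
instance : NormedField (KinfBar Fq) := spectralNorm.normedField (Kinf Fq) (KinfBar Fq)

theorem norm_algebraMap_KinfBar (x : Kinf Fq) : ‖algebraMap (Kinf Fq) (KinfBar Fq) x‖ = ‖x‖ :=
  spectralNorm_extends x

/-- `ℂ_∞`, the completion of the algebraic closure of `K_∞`. -/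
def Cinf : Type _ := UniformSpace.Completion (KinfBar Fq)

instance : NormedField (Cinf Fq) := inferInstanceAs (NormedField (UniformSpace.Completion (KinfBar Fq)))
instance : CompleteSpace (Cinf Fq) :=
  inferInstanceAs (CompleteSpace (UniformSpace.Completion (KinfBar Fq)))

/-- The embedding `𝔽_q(θ) → ℂ_∞`. -/
def ratToC : RatFunc Fq →+* Cinf Fq :=
  (UniformSpace.Completion.coeRingHom (α := KinfBar Fq)).comp
    ((algebraMap (Kinf Fq) (KinfBar Fq)).comp (ofRat Fq))

theorem norm_ratToC (x : RatFunc Fq) : ‖ratToC Fq x‖ = absInfty Fq x :=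
  (UniformSpace.Completion.norm_coe (E := KinfBar Fq) _).trans
    ((norm_algebraMap_KinfBar Fq _).trans (norm_ofRat Fq x))

instance : IsUltrametricDist (Cinf Fq) :=
  IsUltrametricDist.isUltrametricDist_of_forall_norm_natCast_le_one fun n => by
    rw [← map_natCast (ratToC Fq), norm_ratToC]
    exact absInfty_natCast_le_one Fq n

instance : Algebra Fq (Cinf Fq) := ((ratToC Fq).comp RatFunc.C).toAlgebra

/-- The element `θ` of `ℂ_∞`. -/
def theta : Cinf Fq := ratToC Fq RatFunc.X

theorem norm_theta : ‖theta Fq‖ = Fintype.card Fq :=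
  (norm_ratToC Fq _).trans (absInfty_X Fq)

/-! ### The Tate algebra, Frobenius twist, and `Ω` -/

/-- The Tate algebra `𝕋`: the power series over `ℂ_∞` that converge on `|t|_∞ ≤ 1`. -/
def Tate : Subalgebra Fq (Cinf Fq)⟦X⟧ where
  carrier := {f | IsRestricted 1 f}
  mul_mem' := isRestricted.mul 1
  add_mem' := isRestricted.add 1
  algebraMap_mem' r := by
    have h : algebraMap Fq (Cinf Fq)⟦X⟧ r = C (algebraMap Fq (Cinf Fq) r) := by
      rw [PowerSeries.algebraMap_apply]
    exact h ▸ isRestricted_C 1 (algebraMap Fq (Cinf Fq) r)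

/-- The constant `z`, as an element of `𝕋`. -/
def constT (z : Cinf Fq) : Tate Fq := ⟨C z, isRestricted_C 1 z⟩

/-- The variable `t`, as an element of `𝕋`. -/
def varT : Tate Fq := ⟨X, isRestricted_monomial 1 1 1⟩

/-- The Frobenius twist `∑ aᵢ tⁱ ↦ ∑ aᵢ^q tⁱ`. -/
def twist : (Cinf Fq)⟦X⟧ →+* (Cinf Fq)⟦X⟧ :=
  PowerSeries.map (FiniteField.frobeniusAlgHom Fq (Cinf Fq)).toRingHom

variable {Fq}

/-- The partial product `η^{-q} ∏_{1 ≤ i ≤ m} (1 - t / θ^{q^i})`. -/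
def omegaPartial (η : Cinf Fq) (m : ℕ) : (Cinf Fq)⟦X⟧ :=
  C (η ^ Fintype.card Fq)⁻¹ *
    ∏ i ∈ Finset.range m, (1 - C (theta Fq ^ Fintype.card Fq ^ (i + 1))⁻¹ * X)

/-- `Ω(t) = (-θ)^{-q/(q-1)} ∏_{i ≥ 1} (1 - t / θ^{q^i})`, as the coefficientwise limit of the
partial products. Here `η` is the chosen `(q-1)`-th root of `-θ`. -/
def Omega (η : Cinf Fq) : (Cinf Fq)⟦X⟧ :=
  PowerSeries.mk fun k => limUnder atTop fun m => coeff k (omegaPartial η m)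

/-- The limits defining `Ω` exist. -/
theorem tendsto_coeff_omegaPartial (η : Cinf Fq) (k : ℕ) :
    Tendsto (fun m => coeff k (omegaPartial η m)) atTop (𝓝 (coeff k (Omega η))) := by
  have hq : (1 : ℝ) < Fintype.card Fq := by exact_mod_cast Fintype.one_lt_card
  have hq0 : (0 : ℝ) < Fintype.card Fq := by linarith
  have hb : ∀ m : ℕ, ‖(theta Fq ^ Fintype.card Fq ^ (m + 1))⁻¹‖ ≤ (Fintype.card Fq : ℝ)⁻¹ ^ m := by
    intro m
    rw [norm_inv, norm_pow, norm_theta, inv_pow]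
    refine inv_anti₀ (by positivity) (pow_le_pow_right₀ hq.le ?_)
    exact (Nat.le_succ m).trans (Nat.lt_pow_self Fintype.one_lt_card).le
  have hsucc : ∀ m, omegaPartial η (m + 1) = omegaPartial η m -
      C (theta Fq ^ Fintype.card Fq ^ (m + 1))⁻¹ * (X * omegaPartial η m) := by
    intro m
    simp only [omegaPartial, Finset.prod_range_succ]
    ring
  have hbound : ∀ m k, ‖coeff k (omegaPartial η m)‖ ≤ ‖(η ^ Fintype.card Fq)⁻¹‖ := by
    intro m
    induction m with
    | zero =>
      intro k
      simp only [omegaPartial, Finset.range_zero, Finset.prod_empty, mul_one, coeff_C]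
      split_ifs <;> simp
    | succ m ih =>
      intro k
      rw [hsucc, map_sub, coeff_C_mul, sub_eq_add_neg]
      refine (IsUltrametricDist.norm_add_le_max _ _).trans (max_le (ih k) ?_)
      rw [norm_neg, norm_mul]
      have h1 : ‖(theta Fq ^ Fintype.card Fq ^ (m + 1))⁻¹‖ ≤ 1 :=
        (hb m).trans (pow_le_one₀ (by positivity) (inv_le_one_of_one_le₀ hq.le))
      cases k with
      | zero => simp
      | succ k =>
        rw [coeff_succ_X_mul]
        exact (mul_le_of_le_one_left (norm_nonneg _) h1).trans (ih k)
  have hc : CauchySeq fun m => coeff k (omegaPartial η m) := by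
    refine cauchySeq_of_le_geometric (Fintype.card Fq : ℝ)⁻¹ ‖(η ^ Fintype.card Fq)⁻¹‖
      (inv_lt_one_of_one_lt₀ hq) fun m => ?_
    rw [hsucc, map_sub, coeff_C_mul, dist_eq_norm, sub_sub_cancel, norm_mul, mul_comm]
    refine mul_le_mul ?_ (hb m) (norm_nonneg _) (norm_nonneg _)
    cases k with
    | zero => simp
    | succ k => rw [coeff_succ_X_mul]; exact hbound m k
  simpa [Omega] using tendsto_nhds_limUnder (cauchySeq_tendsto_of_complete hc)

/-! ### The continued `t`-motivic polylogarithm and the operator `L` -/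

/-- `g ∈ 𝕋` represents the class of the continued `𝔏𝔦₀(Y)` in `𝕋 / 𝔽_q[t]`, i.e. it solves the
Artin-Schreier equation `g - g⁽¹⁾ = Y`. -/
def IsLi0Value (Y : (Cinf Fq)⟦X⟧) (g : Tate Fq) : Prop :=
  (g : (Cinf Fq)⟦X⟧) - twist Fq g = Y

/-- `f ∈ 𝕋` represents the class of the continued `𝔏𝔦ₙ(Z) = Ω^{-n} 𝔏𝔦₀(Ωⁿ Z)` in
`𝕋 / Ω^{-n} 𝔽_q[t]`. -/
def IsLiValue (η : Cinf Fq) (n : ℕ) (Z f : Tate Fq) : Prop :=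
  ∃ g : Tate Fq, IsLi0Value (Omega η ^ n * (Z : (Cinf Fq)⟦X⟧)) g ∧
    (f : (Cinf Fq)⟦X⟧) = (Omega η)⁻¹ ^ n * (g : (Cinf Fq)⟦X⟧)

/-- A branch of the continued `𝔏𝔦ₙ`: an `𝔽_q`-linear lift `𝕋 → 𝕋` of the map
`𝕋 → 𝕋 / Ω^{-n} 𝔽_q[t]`. -/
structure LiBranch (η : Cinf Fq) (n : ℕ) where
  toLinearMap : Tate Fq →ₗ[Fq] Tate Fq
  isLift : ∀ Z, IsLiValue η n Z (toLinearMap Z)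

/-- The operator `L(F)(Z) = t F(Z) - F(θ Z)` on maps `F : 𝕋 → 𝕋`. -/
def opL (F : Tate Fq → Tate Fq) : Tate Fq → Tate Fq :=
  fun Z => varT Fq * F Z - F (constT Fq (theta Fq) * Z)

/-- The coefficient `c_j` in the expansion `f = ∑ c_j (t - θ)^j` of a power series converging on
`|t|_∞ ≤ q`: if `f = ∑ a_k t^k`, then `c_j = ∑_k (k choose j) a_k θ^{k-j}`. -/
def thetaCoeff (f : (Cinf Fq)⟦X⟧) (j : ℕ) : Cinf Fq :=
  ∑' k : ℕ, (k.choose j : Cinf Fq) * coeff k f * theta Fq ^ (k - j)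

/-- `δ₀ⁿ(f) = (c_{n-1}, …, c₁, c₀)` for `f = ∑ c_j (t - θ)^j`. Coordinates are numbered from `0`. -/
def delta (n : ℕ) (f : (Cinf Fq)⟦X⟧) : Fin n → Cinf Fq :=
  fun i => thetaCoeff f (n - 1 - i)

/-! ### The tensor power `C^{⊗n}`, its exponential, and the period lattice -/

/-- The nilpotent matrix with ones on the superdiagonal. -/
def matN (n : ℕ) : Matrix (Fin n) (Fin n) (Cinf Fq) :=
  Matrix.of fun i j => if (i : ℕ) + 1 = j then 1 else 0

/-- The matrix with a single one, in the lower left corner. -/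
def matE (n : ℕ) : Matrix (Fin n) (Fin n) (Cinf Fq) :=
  Matrix.of fun i j => if (i : ℕ) + 1 = n ∧ (j : ℕ) = 0 then 1 else 0

/-- `dρₙ(t) = θ I + N`. -/
def matD (n : ℕ) : Matrix (Fin n) (Fin n) (Cinf Fq) :=
  theta Fq • (1 : Matrix (Fin n) (Fin n) (Cinf Fq)) + matN n

/-- The `i`-th iterate of the `q`-Frobenius `τ`, on vectors. -/
def frobVec {n : ℕ} (i : ℕ) (z : Fin n → Cinf Fq) : Fin n → Cinf Fq :=
  fun k => z k ^ Fintype.card Fq ^ i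

/-- The `i`-th iterate of the `q`-Frobenius, on matrices. -/
def frobMat {n : ℕ} (i : ℕ) (M : Matrix (Fin n) (Fin n) (Cinf Fq)) :
    Matrix (Fin n) (Fin n) (Cinf Fq) :=
  M.map fun x => x ^ Fintype.card Fq ^ i

/-- The action `ρₙ(t) = θ I + N + E τ` on `ℂ_∞ⁿ`. -/
def rhoT (n : ℕ) (z : Fin n → Cinf Fq) : Fin n → Cinf Fq :=
  matD n *ᵥ z + matE n *ᵥ frobVec 1 z

/-- `∑ αᵢ τⁱ` is the exponential series of `C^{⊗n}`: `α₀ = I`, and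
`(∑ αᵢ τⁱ) (θ I + N) = (θ I + N + E τ) (∑ αᵢ τⁱ)` in the ring of twisted power series. -/
def IsExpSeries {n : ℕ} (α : ℕ → Matrix (Fin n) (Fin n) (Cinf Fq)) : Prop :=
  α 0 = 1 ∧ ∀ i, α (i + 1) * frobMat (i + 1) (matD n) =
    matD n * α (i + 1) + matE n * frobMat 1 (α i)

theorem matN_pow_apply (n k : ℕ) (i j : Fin n) :
    (matN (Fq := Fq) n ^ k) i j = if (i : ℕ) + k = j then 1 else 0 := by
  induction k generalizing j with
  | zero => simp [Matrix.one_apply, Fin.ext_iff]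
  | succ k ih =>
    rw [pow_succ, Matrix.mul_apply]
    have hN : ∀ b, matN (Fq := Fq) n b j = if (b : ℕ) + 1 = j then 1 else 0 := fun _ => rfl
    simp only [ih, hN]
    by_cases h : (i : ℕ) + (k + 1) = j
    · rw [if_pos h, Finset.sum_eq_single ⟨(i : ℕ) + k, by omega⟩]
      · rw [if_pos rfl, if_pos (by simpa [add_assoc] using h), mul_one]
      · intro b _ hb
        rw [if_neg, zero_mul]
        intro h'
        exact hb (Fin.ext h'.symm)
      · simp
    · rw [if_neg h]
      refine Finset.sum_eq_zero fun b _ => ?_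
      split_ifs <;> first | omega | simp

theorem isNilpotent_matN (n : ℕ) : IsNilpotent (matN (Fq := Fq) n) := by
  refine ⟨n, ?_⟩
  ext i j
  rw [matN_pow_apply, if_neg (by omega), Matrix.zero_apply]

theorem theta_pow_ne (i : ℕ) : theta Fq ^ Fintype.card Fq ^ (i + 1) - theta Fq ≠ 0 := by
  intro h
  have hq : (1 : ℝ) < Fintype.card Fq := by exact_mod_cast Fintype.one_lt_card
  have h1 := congrArg norm (sub_eq_zero.mp h)
  rw [norm_pow, norm_theta] at h1
  have h2 : (Fintype.card Fq : ℝ) ^ 1 < (Fintype.card Fq : ℝ) ^ Fintype.card Fq ^ (i + 1) :=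
    pow_lt_pow_right₀ hq (Nat.one_lt_pow (by omega) Fintype.one_lt_card)
  rw [h1, pow_one] at h2
  exact lt_irrefl _ h2

theorem frobMat_matD (n i : ℕ) : frobMat i (matD (Fq := Fq) n) =
    theta Fq ^ Fintype.card Fq ^ i • (1 : Matrix (Fin n) (Fin n) (Cinf Fq)) + matN n := by
  have h0 : Fintype.card Fq ^ i ≠ 0 := pow_ne_zero _ Fintype.card_ne_zero
  ext a b
  simp only [frobMat, matD, matN, Matrix.map_apply, Matrix.add_apply, Matrix.smul_apply,
    Matrix.one_apply, Matrix.of_apply, smul_eq_mul]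
  by_cases h : a = b
  · subst h; simp
  · by_cases h' : (a : ℕ) + 1 = b <;> simp [h, h']

/-- The recursion for the coefficients of the exponential has a unique solution at each step. -/
theorem existsUnique_sylvester (n i : ℕ) (Y : Matrix (Fin n) (Fin n) (Cinf Fq)) :
    ∃! A : Matrix (Fin n) (Fin n) (Cinf Fq),
      A * frobMat (i + 1) (matD n) = matD n * A + Y := by
  set c := theta Fq ^ Fintype.card Fq ^ (i + 1) - theta Fq with hc
  let M := Matrix (Fin n) (Fin n) (Cinf Fq)
  have hl : IsNilpotent (LinearMap.mulLeft (Cinf Fq) (matN (Fq := Fq) n)) :=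
    (LinearMap.isNilpotent_mulLeft_iff _ _).2 (isNilpotent_matN n)
  have hr : IsNilpotent (LinearMap.mulRight (Cinf Fq) (matN (Fq := Fq) n)) :=
    (LinearMap.isNilpotent_mulRight_iff _ _).2 (isNilpotent_matN n)
  have hn := (LinearMap.commute_mulLeft_right (R := Cinf Fq) (matN (Fq := Fq) n)
    (matN n)).symm.isNilpotent_sub hr hl
  have hu : IsUnit (algebraMap (Cinf Fq) (Module.End (Cinf Fq) M) c) :=
    (IsUnit.mk0 c (theta_pow_ne i)).map _
  have hU := hn.isUnit_add_left_of_commute hu (Algebra.commutes c _).symm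
  have hbij := (Module.End.isUnit_iff _).1 hU
  have key : ∀ A : M, A * frobMat (i + 1) (matD n) = matD n * A + Y ↔
      (algebraMap (Cinf Fq) (Module.End (Cinf Fq) M) c +
        (LinearMap.mulRight (Cinf Fq) (matN n) - LinearMap.mulLeft (Cinf Fq) (matN n)) :
          Module.End (Cinf Fq) M) A = Y := by
    intro A
    rw [frobMat_matD, matD]
    simp only [LinearMap.add_apply, LinearMap.sub_apply, LinearMap.mulRight_apply,
      LinearMap.mulLeft_apply, Module.algebraMap_end_apply, mul_add, add_mul, mul_smul_comm,
      smul_mul_assoc, mul_one, one_mul, hc, sub_smul]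
    rw [← sub_eq_zero, ← sub_eq_zero (b := Y)]
    refine Eq.congr ?_ rfl
    abel
  obtain ⟨A, hA, hA'⟩ := hbij.existsUnique Y
  exact ⟨A, (key A).2 hA, fun B hB => hA' B ((key B).1 hB)⟩

theorem existsUnique_isExpSeries (n : ℕ) :
    ∃! α : ℕ → Matrix (Fin n) (Fin n) (Cinf Fq), IsExpSeries α := by
  choose f hf hf' using fun (i : ℕ) (B : Matrix (Fin n) (Fin n) (Cinf Fq)) =>
    existsUnique_sylvester n i (matE n * frobMat 1 B)
  obtain ⟨α, h0, hs⟩ : ∃ α : ℕ → Matrix (Fin n) (Fin n) (Cinf Fq),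
      α 0 = 1 ∧ ∀ i, α (i + 1) = f i (α i) := ⟨fun i => Nat.rec 1 f i, rfl, fun _ => rfl⟩
  refine ⟨α, ⟨h0, fun i => ?_⟩, fun β hβ => ?_⟩
  · rw [hs]
    exact hf i (α i)
  · funext i
    induction i with
    | zero => rw [hβ.1, h0]
    | succ i ih => rw [hf' i _ _ (hβ.2 i), ih, hs]

/-- The coefficients of `Exp_{C^{⊗n}}`. -/
def expCoeff (n : ℕ) : ℕ → Matrix (Fin n) (Fin n) (Cinf Fq) :=
  (existsUnique_isExpSeries (Fq := Fq) n).choose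

theorem isExpSeries_expCoeff (n : ℕ) : IsExpSeries (expCoeff (Fq := Fq) n) :=
  (existsUnique_isExpSeries (Fq := Fq) n).choose_spec.1

/-- The `i`-th iterate of the `q`-Frobenius is a ring endomorphism of `ℂ_∞`. -/
theorem exists_frobHom (i : ℕ) :
    ∃ φ : Cinf Fq →+* Cinf Fq, ∀ x, φ x = x ^ Fintype.card Fq ^ i := by
  induction i with
  | zero => exact ⟨RingHom.id _, by simp⟩
  | succ i ih =>
    obtain ⟨φ, hφ⟩ := ih
    refine ⟨(FiniteField.frobeniusAlgHom Fq (Cinf Fq)).toRingHom.comp φ, fun x => ?_⟩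
    simp [hφ, ← pow_mul, pow_succ]

theorem frobVec_add {n : ℕ} (i : ℕ) (z w : Fin n → Cinf Fq) :
    frobVec i (z + w) = frobVec i z + frobVec i w := by
  obtain ⟨φ, hφ⟩ := exists_frobHom (Fq := Fq) i
  funext k
  simp [frobVec, ← hφ]

theorem frobVec_neg {n : ℕ} (i : ℕ) (z : Fin n → Cinf Fq) :
    frobVec i (-z) = -frobVec i z := by
  obtain ⟨φ, hφ⟩ := exists_frobHom (Fq := Fq) i
  funext k
  simp [frobVec, ← hφ]

theorem frobVec_zero {n : ℕ} (i : ℕ) : frobVec i (0 : Fin n → Cinf Fq) = 0 := by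
  obtain ⟨φ, hφ⟩ := exists_frobHom (Fq := Fq) i
  funext k
  simp [frobVec, ← hφ]

theorem frobVec_mulVec {n : ℕ} (i : ℕ) (M : Matrix (Fin n) (Fin n) (Cinf Fq))
    (z : Fin n → Cinf Fq) : frobVec i (M *ᵥ z) = frobMat i M *ᵥ frobVec i z := by
  obtain ⟨φ, hφ⟩ := exists_frobHom (Fq := Fq) i
  funext k
  simp [frobVec, frobMat, Matrix.mulVec, dotProduct, ← hφ]

theorem frobVec_one_frobVec {n : ℕ} (i : ℕ) (z : Fin n → Cinf Fq) :
    frobVec 1 (frobVec i z) = frobVec (i + 1) z := by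
  funext k
  simp [frobVec, ← pow_mul, pow_succ]

/-- `Λₙ`, the kernel of `Exp_{C^{⊗n}}(z) = ∑ αᵢ z⁽ⁱ⁾` on `ℂ_∞ⁿ`. -/
def Lambda (Fq : Type*) [Field Fq] [Fintype Fq] (n : ℕ) : AddSubgroup (Fin n → Cinf Fq) where
  carrier := {z | HasSum (fun i => expCoeff n i *ᵥ frobVec i z) 0}
  zero_mem' := by
    simp [frobVec_zero, hasSum_zero]
  add_mem' {z w} hz hw := by
    have h := HasSum.add hz hw
    simpa only [Set.mem_ofPred_eq, frobVec_add, Matrix.mulVec_add, add_zero] using h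
  neg_mem' {z} hz := by
    have h := HasSum.neg hz
    simpa only [Set.mem_ofPred_eq, frobVec_neg, Matrix.mulVec_neg, neg_zero] using h

theorem matD_mulVec_mem_Lambda (n : ℕ) {z : Fin n → Cinf Fq} (hz : z ∈ Lambda Fq n) :
    matD n *ᵥ z ∈ Lambda Fq n := by
  change HasSum (fun i => expCoeff n i *ᵥ frobVec i z) 0 at hz
  change HasSum (fun i => expCoeff n i *ᵥ frobVec i (matD n *ᵥ z)) 0
  obtain ⟨h0, hs⟩ := isExpSeries_expCoeff (Fq := Fq) n
  have hD : HasSum (fun i => matD n *ᵥ (expCoeff n i *ᵥ frobVec i z)) 0 := by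
    have h := hz.map (Matrix.mulVecLin (matD (Fq := Fq) n)).toAddMonoidHom
      (Continuous.matrix_mulVec (A := fun _ => matD n) continuous_const continuous_id)
    simpa [Function.comp_def] using h
  have hE : HasSum (fun i => matE n *ᵥ frobVec 1 (expCoeff n i *ᵥ frobVec i z)) 0 := by
    let ψ : (Fin n → Cinf Fq) →+ (Fin n → Cinf Fq) :=
      { toFun := fun v => matE n *ᵥ frobVec 1 v
        map_zero' := by simp [frobVec_zero]
        map_add' := fun v w => by simp [frobVec_add, Matrix.mulVec_add] }
    have hψ : Continuous ψ := by
      refine Continuous.matrix_mulVec (A := fun _ => matE n) continuous_const (continuous_pi fun k => ?_)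
      exact (continuous_apply k).pow _
    have h := hz.map ψ hψ
    simpa [Function.comp_def, ψ, frobVec_zero] using h
  rw [← hasSum_nat_add_iff' 1] at hD ⊢
  have h := hD.add hE
  convert h using 1
  · funext i
    rw [frobVec_mulVec, frobVec_mulVec, frobVec_one_frobVec, Matrix.mulVec_mulVec, hs,
      Matrix.add_mulVec, Matrix.mulVec_mulVec, Matrix.mulVec_mulVec]
  · have h1 : ∀ w : Fin n → Cinf Fq, frobVec 0 w = w := fun w => by
      funext k; simp [frobVec]
    simp [h0, h1]

/-- The action of `θ I + N` on `ℂ_∞ⁿ / Λₙ`. -/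
def dRhoQuot (n : ℕ) : (Fin n → Cinf Fq) ⧸ Lambda Fq n →+ (Fin n → Cinf Fq) ⧸ Lambda Fq n :=
  QuotientAddGroup.map _ _ (Matrix.mulVecLin (matD n)).toAddMonoidHom
    fun _ hz => matD_mulVec_mem_Lambda n hz

/-! ### The continued logarithm -/

/-- `∑_{k=1}^n δ₀ⁿ(L^{n-k}(𝔏𝔦ₙ)(z_k))` modulo `Λₙ`, computed with a branch of `𝔏𝔦ₙ`.
Coordinates are numbered from `0` here, so `n - k` becomes `n - 1 - k`. -/
def logOfBranch {η : Cinf Fq} {n : ℕ} (B : LiBranch η n) (z : Fin n → Cinf Fq) :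
    (Fin n → Cinf Fq) ⧸ Lambda Fq n :=
  QuotientAddGroup.mk (∑ k : Fin n,
    delta n (opL^[n - 1 - k] B.toLinearMap (constT Fq (z k)) : (Cinf Fq)⟦X⟧))

open Classical in
/-- The continued logarithm `ℂ_∞ⁿ → ℂ_∞ⁿ / Λₙ`, computed with some branch of `𝔏𝔦ₙ`. -/
def vecLog (η : Cinf Fq) (n : ℕ) (z : Fin n → Cinf Fq) : (Fin n → Cinf Fq) ⧸ Lambda Fq n :=
  if h : Nonempty (LiBranch η n) then logOfBranch h.some z else 0

end CarlitzLog

end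

/-! Since Ω = (t - θ^q) Ω^{(1)}, a series f is a value of 𝔏𝔦ₙ at Z exactly when f^{(1)} = (t -
θ^q)^n (f - Z) (`isLiValue_iff`). Two values at Z differ by a solution of the homogeneous equation
f^{(1)} = (t - θ^q)^n f. These solutions are stable under multiplication by t, so modulo them 𝔏𝔦ₙ
commutes with t and L multiplies the argument by t - θ.

The main point is that δ₀ⁿ sends homogeneous solutions into Λₙ (`delta_mem_Lambda`). Coordinate a
(counted from 0) of the i-th term of Exp(δ₀ⁿ f) is the residue at θ^{q^i} of f^{(i)} / ((t -
θ)^{n-a} ∏_{1≤j≤i} (t - θ^{q^j})^n). By the homogeneous equation this quotient is the same for all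
i, so a partial sum of Exp is the sum of all residues of one quotient in the disc |t| ≤ |θ^{q^m}|.
An ultrametric residue estimate shows that it tends to 0.

The functional equation comes from an identity in 𝕋: for P(z) = ∑ (t - θ)^{n-k} z_k, one has P(ρₙ(t)
z) = t P(z) - ((t - θ)^n z_1 - z_1^q). The bracket has the explicit polylogarithm value (t - θ)^n
z_1, which δ₀ⁿ kills, while δ₀ⁿ turns multiplication by t into θI + N. Branches exist because
Artin-Schreier equations are solvable in ℂ_∞, coefficient by coefficient. -/

noncomputable section

namespace CarlitzLog

open Filter Topology PowerSeries
open scoped Matrix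

/-! ### Residues of rational functions -/

section Residue

variable {K : Type*} [Field K]

/-- The expansion of a polynomial at `x`, as a Laurent series in the local parameter. -/
def laurentExpansion (x : K) : Polynomial K →+* LaurentSeries K :=
  (HahnSeries.ofPowerSeries ℤ K).comp
    (Polynomial.coeToPowerSeries.ringHom.comp (Polynomial.taylorAlgHom x).toRingHom)

theorem laurentExpansion_apply (x : K) (P : Polynomial K) :
    laurentExpansion x P = HahnSeries.ofPowerSeries ℤ K (Polynomial.taylor x P : Polynomial K) :=
  rfl

theorem laurentExpansion_injective (x : K) : Function.Injective (laurentExpansion x) :=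
  HahnSeries.ofPowerSeries_injective.comp
    ((Polynomial.coe_injective K).comp (Polynomial.taylor_injective x))

theorem laurentExpansion_C (x a : K) : laurentExpansion x (Polynomial.C a) = HahnSeries.C a := by
  rw [laurentExpansion_apply, Polynomial.taylor_C, Polynomial.coe_C, HahnSeries.ofPowerSeries_C]

theorem laurentExpansion_X_sub_C_self (x : K) :
    laurentExpansion x (Polynomial.X - Polynomial.C x) = HahnSeries.single 1 1 := by
  rw [laurentExpansion_apply, map_sub, Polynomial.taylor_X, Polynomial.taylor_C,
    add_sub_cancel_right, Polynomial.coe_X, HahnSeries.ofPowerSeries_X]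

/-- The residue at `x` of the rational function `g / P`. -/
def residue (x : K) (P g : Polynomial K) : K :=
  (laurentExpansion x g / laurentExpansion x P).coeff (-1)

theorem residue_add (x : K) (P g h : Polynomial K) :
    residue x P (g + h) = residue x P g + residue x P h := by
  simp [residue, add_div]

theorem residue_C_mul (x : K) (P : Polynomial K) (a : K) (g : Polynomial K) :
    residue x P (Polynomial.C a * g) = a * residue x P g := by
  rw [residue, map_mul, laurentExpansion_C, mul_div_assoc, HahnSeries.C_mul_eq_smul, HahnSeries.coeff_smul,
    smul_eq_mul, residue]

theorem residue_zero (x : K) (P : Polynomial K) : residue x P 0 = 0 := by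
  simp [residue]

theorem residue_sub (x : K) (P g h : Polynomial K) :
    residue x P (g - h) = residue x P g - residue x P h := by
  simp [residue, sub_div]

theorem residue_sum {ι : Type*} (s : Finset ι) (x : K) (P : Polynomial K)
    (g : ι → Polynomial K) : residue x P (∑ i ∈ s, g i) = ∑ i ∈ s, residue x P (g i) := by
  classical
  induction s using Finset.induction_on with
  | empty => simp [residue_zero]
  | insert i s hi ih => rw [Finset.sum_insert hi, Finset.sum_insert hi, residue_add, ih]

theorem residue_mul_mul_left (x : K) (P g : Polynomial K) {Q : Polynomial K} (hQ : Q ≠ 0) :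
    residue x (Q * P) (Q * g) = residue x P g := by
  have h : laurentExpansion x Q ≠ 0 :=
    (map_ne_zero_iff _ (laurentExpansion_injective x)).2 hQ
  rw [residue, map_mul, map_mul, mul_div_mul_left _ _ h, residue]

theorem residue_eq_zero_of_eval_ne_zero (x : K) {P : Polynomial K} (hP : P.eval x ≠ 0)
    (g : Polynomial K) : residue x P g = 0 := by
  set p : K⟦X⟧ := ((Polynomial.taylor x P : Polynomial K) : K⟦X⟧) with hp
  have hc : constantCoeff p ≠ 0 := by
    rw [hp, ← coeff_zero_eq_constantCoeff_apply, Polynomial.coeff_coe,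
      Polynomial.taylor_coeff_zero]
    exact hP
  have h1 : HahnSeries.ofPowerSeries ℤ K p * HahnSeries.ofPowerSeries ℤ K p⁻¹ = 1 := by
    rw [← map_mul, PowerSeries.mul_inv_cancel _ hc, map_one]
  rw [residue, laurentExpansion_apply, laurentExpansion_apply, ← hp, div_eq_mul_inv,
    inv_eq_of_mul_eq_one_right h1, ← map_mul, PowerSeries.coeff_coe, if_pos (by norm_num)]

theorem residue_X_sub_C_pow (x : K) (n m : ℕ) :
    residue x ((Polynomial.X - Polynomial.C x) ^ n) ((Polynomial.X - Polynomial.C x) ^ m) =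
      if m + 1 = n then 1 else 0 := by
  have h0 : (Polynomial.X - Polynomial.C x : Polynomial K) ≠ 0 := Polynomial.X_sub_C_ne_zero x
  rcases le_or_gt n m with h | h
  · obtain ⟨k, rfl⟩ := Nat.exists_eq_add_of_le h
    have := residue_mul_mul_left x 1 ((Polynomial.X - Polynomial.C x) ^ k) (pow_ne_zero n h0)
    rw [mul_one, ← pow_add] at this
    rw [this, residue_eq_zero_of_eval_ne_zero x (by simp), if_neg (by omega)]
  · obtain ⟨k, rfl⟩ := Nat.exists_eq_add_of_lt h
    have := residue_mul_mul_left x ((Polynomial.X - Polynomial.C x) ^ (k + 1)) 1 (pow_ne_zero m h0)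
    rw [mul_one, ← pow_add] at this
    rw [add_assoc, this, residue, map_pow, laurentExpansion_X_sub_C_self, map_one, one_div,
      HahnSeries.single_pow, HahnSeries.inv_single]
    by_cases hk : k = 0
    · subst hk; simp
    · rw [if_neg (by omega), HahnSeries.coeff_single_of_ne]
      simp only [nsmul_eq_mul]
      push_cast
      omega

theorem residue_X_pow (x : K) (P : Polynomial K) (k : ℕ) :
    residue x P (Polynomial.X ^ k) = ∑ j ∈ Finset.range (k + 1),
      (k.choose j : K) * x ^ (k - j) * residue x P ((Polynomial.X - Polynomial.C x) ^ j) := by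
  have hX : (Polynomial.X ^ k : Polynomial K) = ∑ j ∈ Finset.range (k + 1),
      Polynomial.C ((k.choose j : K) * x ^ (k - j)) * (Polynomial.X - Polynomial.C x) ^ j := by
    nth_rewrite 1 [← sub_add_cancel (Polynomial.X : Polynomial K) (Polynomial.C x)]
    rw [add_pow]
    refine Finset.sum_congr rfl fun j _ => ?_
    simp only [map_mul, map_pow, map_natCast]
    ring
  rw [hX, residue_sum]
  exact Finset.sum_congr rfl fun j _ => residue_C_mul _ _ _ _

/-- The hypothesis bounds the pole order at x by n, so the binomial sum has a length independent of
k; terms with j > k vanish with the binomial coefficient. -/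
theorem residue_X_pow_of_le (x : K) {P : Polynomial K} {n : ℕ}
    (hP : ∀ j ≥ n, residue x P ((Polynomial.X - Polynomial.C x) ^ j) = 0) (k : ℕ) :
    residue x P (Polynomial.X ^ k) = ∑ j ∈ Finset.range n,
      (k.choose j : K) * x ^ (k - j) * residue x P ((Polynomial.X - Polynomial.C x) ^ j) := by
  rw [residue_X_pow]
  rcases le_total n (k + 1) with h | h
  · refine (Finset.sum_subset (Finset.range_subset_range.2 h) fun j _ hj => ?_).symm
    rw [hP j (by simpa using hj), mul_zero]
  · refine Finset.sum_subset (Finset.range_subset_range.2 h) fun j _ hj => ?_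
    rw [Nat.choose_eq_zero_of_lt (by simpa using hj)]
    simp

/-- These residues are the weights in `thetaCoeff`. -/
theorem residue_X_sub_C_pow_X_pow (x : K) (n k : ℕ) :
    residue x ((Polynomial.X - Polynomial.C x) ^ (n + 1)) (Polynomial.X ^ k) =
      (k.choose n : K) * x ^ (k - n) := by
  rw [residue_X_pow_of_le (n := n + 1) x fun j hj => by
    rw [residue_X_sub_C_pow, if_neg (by omega)], Finset.sum_range_succ,
    Finset.sum_eq_zero fun j hj => ?_]
  · rw [residue_X_sub_C_pow, if_pos rfl, zero_add, mul_one]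
  · rw [residue_X_sub_C_pow, if_neg (by simp at hj; omega), mul_zero]

/-- Residues are compatible with embeddings of fields. -/
theorem residue_map {L : Type*} [Field L] (φ : K →+* L) (x : K) (P g : Polynomial K) :
    residue (φ x) (P.map φ) (g.map φ) = φ (residue x P g) := by
  -- Applying φ to coefficients is a ring map of Laurent series fields that intertwines the
  -- expansions at x and at φ x, so it respects quotients.
  let Φ : LaurentSeries K →+* LaurentSeries L :=
    { toFun := fun y => y.map φ
      map_one' := by
        ext i
        rw [HahnSeries.map_coeff, HahnSeries.coeff_one, HahnSeries.coeff_one]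
        split_ifs <;> simp
      map_zero' := by ext i; simp
      map_add' := fun y z => by ext i; simp
      map_mul' := fun y z => HahnSeries.map_mul (φ : K →ₙ+* L) }
  have hΦ : ∀ y, (Φ y).coeff (-1) = φ (y.coeff (-1)) := fun y => rfl
  have hexp : ∀ Q : Polynomial K, laurentExpansion (φ x) (Q.map φ) = Φ (laurentExpansion x Q) := by
    intro Q
    ext i
    change _ = φ ((laurentExpansion x Q).coeff i)
    rw [laurentExpansion_apply, laurentExpansion_apply, ← Polynomial.map_taylor]
    erw [PowerSeries.coeff_coe, PowerSeries.coeff_coe]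
    split_ifs
    · simp
    · rw [Polynomial.coeff_coe, Polynomial.coeff_coe, Polynomial.coeff_map]
  rw [residue, hexp, hexp, ← map_div₀, hΦ, residue]

/-- The monic polynomial with the given roots. -/
def rootPoly (M : Multiset K) : Polynomial K :=
  (M.map fun y => Polynomial.X - Polynomial.C y).prod

theorem rootPoly_cons (y : K) (M : Multiset K) :
    rootPoly (y ::ₘ M) = (Polynomial.X - Polynomial.C y) * rootPoly M := by
  simp [rootPoly]

theorem rootPoly_eval_ne_zero {x : K} {M : Multiset K} (h : x ∉ M) :
    (rootPoly M).eval x ≠ 0 := by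
  induction M using Multiset.induction_on with
  | empty => simp [rootPoly]
  | cons y M ih =>
    rw [rootPoly_cons, Polynomial.eval_mul]
    simp only [Multiset.mem_cons, not_or] at h
    refine mul_ne_zero ?_ (ih h.2)
    simpa [sub_eq_zero] using h.1

theorem residue_rootPoly_cons (x y : K) (M : Multiset K) (g : Polynomial K) :
    residue x (rootPoly (y ::ₘ M)) ((Polynomial.X - Polynomial.C y) * g) =
      residue x (rootPoly M) g := by
  rw [rootPoly_cons, residue_mul_mul_left _ _ _ (Polynomial.X_sub_C_ne_zero y)]

/-- The residue theorem for `1 / ∏ (X - y)`. -/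
theorem sum_residue_rootPoly_one (S : Finset K) (M : Multiset K) (hM : ∀ y ∈ M, y ∈ S) :
    ∑ x ∈ S, residue x (rootPoly M) 1 = if M.card = 1 then 1 else 0 := by
  induction hd : M.card generalizing M with
  | zero =>
    rw [if_neg zero_ne_one]
    refine Finset.sum_eq_zero fun x _ => residue_eq_zero_of_eval_ne_zero x ?_ 1
    rw [Multiset.card_eq_zero] at hd
    exact rootPoly_eval_ne_zero (by simp [hd])
  | succ d ih =>
    obtain ⟨y, hy⟩ := Multiset.card_pos_iff_exists_mem.1 (hd.trans_gt d.succ_pos)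
    obtain ⟨M, rfl⟩ := Multiset.exists_cons_of_mem hy
    rw [Multiset.card_cons, Nat.succ.injEq] at hd
    by_cases h : ∃ z ∈ M, z ≠ y
    · obtain ⟨z, hz, hzy⟩ := h
      obtain ⟨M, rfl⟩ := Multiset.exists_cons_of_mem hz
      simp only [Multiset.mem_cons, forall_eq_or_imp] at hM
      rw [Multiset.card_cons] at hd
      have h1 := ih (y ::ₘ M) (by simpa using ⟨hM.1, hM.2.2⟩) (by simpa using hd)
      have h2 := ih (z ::ₘ M) (by simpa using ⟨hM.2.1, hM.2.2⟩) (by simpa using hd)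
      -- Partial fractions: (y - z) / ((t - y)(t - z)) = 1/(t - y) - 1/(t - z). Both remaining
      -- denominators have degree d, so by induction their residue sums agree and cancel.
      have key : (y - z) * ∑ x ∈ S, residue x (rootPoly (y ::ₘ z ::ₘ M)) 1 = 0 := by
        rw [Finset.mul_sum, ← sub_self (if d = 1 then (1 : K) else 0)]
        nth_rewrite 1 [← h1]
        rw [← h2, ← Finset.sum_sub_distrib]
        refine Finset.sum_congr rfl fun x _ => ?_
        rw [← residue_rootPoly_cons x z (y ::ₘ M), ← residue_rootPoly_cons x y (z ::ₘ M),
          Multiset.cons_swap z y, ← residue_sub, ← residue_C_mul]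
        congr 1
        rw [map_sub]
        ring
      rw [if_neg (by omega)]
      exact (mul_eq_zero.1 key).resolve_left (sub_ne_zero.2 hzy.symm)
    -- All roots coincide, and 1/(t - y)^(d+1) is its own Laurent expansion at y.
    · push Not at h
      have hrep : y ::ₘ M = Multiset.replicate (d + 1) y := by
        rw [Multiset.replicate_succ, Multiset.eq_replicate_of_mem h, hd]
      have hy : y ∈ S := hM y (Multiset.mem_cons_self y M)
      rw [Finset.sum_eq_single_of_mem y hy]
      · rw [hrep, rootPoly, Multiset.map_replicate, Multiset.prod_replicate]
        simpa [eq_comm] using residue_X_sub_C_pow y (d + 1) 0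
      · intro x _ hxy
        refine residue_eq_zero_of_eval_ne_zero x (rootPoly_eval_ne_zero ?_) 1
        rw [hrep, Multiset.mem_replicate]
        exact fun h' => hxy h'.2

end Residue

/-! ### Ultrametric bounds for residues -/

section ResidueNorm

variable {K : Type*} [NormedField K] [IsUltrametricDist K]

/-- The sum over all poles behaves like the coefficient of 1/t at infinity, hence has size at most
r^(k+1-deg), whereas a single residue can be large when poles are close. The induction writes
t^(k+1) = (t - y) t^k + y t^k for a root y: either a root is cancelled or a factor of norm at most r
comes out. -/
theorem norm_sum_residue_rootPoly_le (S : Finset K) {r : ℝ} (hr : 0 ≤ r) (k : ℕ)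
    (M : Multiset K) (hM : ∀ y ∈ M, y ∈ S ∧ ‖y‖ ≤ r) :
    ‖∑ x ∈ S, residue x (rootPoly M) (Polynomial.X ^ k)‖ * r ^ M.card ≤ r ^ (k + 1) := by
  induction k generalizing M with
  | zero =>
    rw [pow_zero, sum_residue_rootPoly_one S M fun y hy => (hM y hy).1]
    split_ifs with h
    · simp [h]
    · simp [hr]
  | succ k ih =>
    rcases M.empty_or_exists_mem with rfl | ⟨y, hy⟩
    · rw [Finset.sum_eq_zero fun x _ => residue_eq_zero_of_eval_ne_zero x
        (rootPoly_eval_ne_zero (Multiset.notMem_zero x)) _]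
      simp only [norm_zero, zero_mul]
      positivity
    · obtain ⟨M, rfl⟩ := Multiset.exists_cons_of_mem hy
      have hX : (Polynomial.X ^ (k + 1) : Polynomial K) =
          (Polynomial.X - Polynomial.C y) * Polynomial.X ^ k + Polynomial.C y * Polynomial.X ^ k := by
        ring
      simp only [hX, residue_add, residue_rootPoly_cons, residue_C_mul, Finset.sum_add_distrib,
        ← Finset.mul_sum]
      have h1 := ih M fun z hz => hM z (Multiset.mem_cons_of_mem hz)
      have h2 := ih (y ::ₘ M) hM
      refine (mul_le_mul_of_nonneg_right (IsUltrametricDist.norm_add_le_max _ _)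
        (by positivity)).trans ?_
      rw [max_mul_of_nonneg _ _ (by positivity)]
      refine max_le ?_ ?_
      · rw [Multiset.card_cons, pow_succ, ← mul_assoc, pow_succ _ (k + 1)]
        exact mul_le_mul_of_nonneg_right h1 hr
      · rw [norm_mul, mul_assoc, pow_succ' _ (k + 1)]
        exact mul_le_mul (hM y hy).2 h2 (by positivity) hr

/-- A crude bound at one pole, sufficient for summability: the pole order is finite, and binomial
coefficients have norm at most 1. -/
theorem exists_norm_residue_X_pow_le {x : K} (hx : 1 ≤ ‖x‖) (P : Polynomial K) :
    ∃ c : ℝ, 0 ≤ c ∧ ∀ k, ‖residue x P (Polynomial.X ^ k)‖ ≤ c * ‖x‖ ^ k := by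
  have hex : ∃ N : ℕ, ∀ j ≥ N, residue x P ((Polynomial.X - Polynomial.C x) ^ j) = 0 := by
    -- The order of the pole of 1/P at x, read as 0 if there is none.
    refine ⟨(-(laurentExpansion x P)⁻¹.order).toNat, fun j hj => ?_⟩
    rw [residue, map_pow, laurentExpansion_X_sub_C_self, HahnSeries.single_pow, one_pow,
      div_eq_mul_inv]
    have : (-1 : ℤ) = (-1 - j) + j • (1 : ℤ) := by simp
    rw [this, HahnSeries.coeff_single_mul_add, one_mul]
    refine HahnSeries.coeff_eq_zero_of_lt_order ?_
    omega
  obtain ⟨N, hN⟩ := hex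
  refine ⟨∑ j ∈ Finset.range N, ‖residue x P ((Polynomial.X - Polynomial.C x) ^ j)‖,
    by positivity, fun k => ?_⟩
  rw [residue_X_pow]
  refine IsUltrametricDist.norm_sum_le_of_forall_le_of_nonneg (by positivity) fun j hj => ?_
  rw [norm_mul, norm_mul, norm_pow, mul_comm]
  refine mul_le_mul ?_ ?_ (by positivity) (by positivity)
  · by_cases h : j < N
    · exact Finset.single_le_sum
        (f := fun j => ‖residue x P ((Polynomial.X - Polynomial.C x) ^ j)‖)
        (fun _ _ => norm_nonneg _) (Finset.mem_range.2 h)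
    · rw [hN j (by omega), norm_zero]
      positivity
  · refine (mul_le_of_le_one_left (by positivity)
      (IsUltrametricDist.norm_natCast_le_one K _)).trans ?_
    exact pow_le_pow_right₀ hx (Nat.sub_le _ _)

end ResidueNorm

/-! ### A residue formula for the coefficients of the exponential -/

theorem rootPoly_add {K : Type*} [Field K] (M M' : Multiset K) :
    rootPoly (M + M') = rootPoly M * rootPoly M' := by
  simp [rootPoly]

theorem rootPoly_replicate {K : Type*} [Field K] (n : ℕ) (y : K) :
    rootPoly (Multiset.replicate n y) = (Polynomial.X - Polynomial.C y) ^ n := by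
  simp [rootPoly]

theorem rootPoly_map {K L : Type*} [Field K] [Field L] (φ : K →+* L) (M : Multiset K) :
    (rootPoly M).map φ = rootPoly (M.map φ) := by
  simp [rootPoly, Polynomial.map_multiset_prod, Multiset.map_map]

variable {Fq : Type*} [Field Fq] [Fintype Fq]

theorem one_lt_card_real (Fq : Type*) [Field Fq] [Fintype Fq] : (1 : ℝ) < Fintype.card Fq := by
  exact_mod_cast Fintype.one_lt_card

variable (Fq) in
/-- The conjugates `θ^{q^i}` of `θ`. -/
def thetaConj (i : ℕ) : Cinf Fq := theta Fq ^ Fintype.card Fq ^ i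

theorem thetaConj_zero : thetaConj Fq 0 = theta Fq := by simp [thetaConj]

theorem thetaConj_succ (i : ℕ) : thetaConj Fq (i + 1) = thetaConj Fq i ^ Fintype.card Fq := by
  rw [thetaConj, thetaConj, ← pow_mul, pow_succ]

theorem norm_thetaConj (i : ℕ) :
    ‖thetaConj Fq i‖ = (Fintype.card Fq : ℝ) ^ Fintype.card Fq ^ i := by
  rw [thetaConj, norm_pow, norm_theta]

theorem norm_thetaConj_strictMono : StrictMono fun i => ‖thetaConj Fq i‖ := by
  intro i j h
  simp only [norm_thetaConj]
  exact pow_lt_pow_right₀ (one_lt_card_real Fq) (Nat.pow_lt_pow_right Fintype.one_lt_card h)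

theorem thetaConj_injective : Function.Injective (thetaConj Fq) := fun _ _ h =>
  norm_thetaConj_strictMono.injective (congrArg norm h)

theorem one_le_norm_thetaConj (i : ℕ) : 1 ≤ ‖thetaConj Fq i‖ := by
  rw [norm_thetaConj]
  exact one_le_pow₀ (one_lt_card_real Fq).le

theorem matN_mul_apply {n : ℕ} (A : Matrix (Fin n) (Fin n) (Cinf Fq)) (a b : Fin n) :
    (matN (Fq := Fq) n * A) a b = if h : (a : ℕ) + 1 < n then A ⟨a + 1, h⟩ b else 0 := by
  rw [Matrix.mul_apply]
  split_ifs with h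
  · rw [Finset.sum_eq_single ⟨a + 1, h⟩]
    · simp [matN]
    · intro c _ hc
      have : (a : ℕ) + 1 ≠ c := fun h' => hc (Fin.ext h'.symm)
      simp [matN, this]
    · simp
  · refine Finset.sum_eq_zero fun c _ => ?_
    have : (a : ℕ) + 1 ≠ c := by omega
    simp [matN, this]

theorem mul_matN_apply {n : ℕ} (A : Matrix (Fin n) (Fin n) (Cinf Fq)) (a b : Fin n) :
    (A * matN (Fq := Fq) n) a b = if 0 < (b : ℕ) then A a ⟨b - 1, by omega⟩ else 0 := by
  rw [Matrix.mul_apply]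
  split_ifs with h
  · rw [Finset.sum_eq_single ⟨b - 1, by omega⟩]
    · have : (b : ℕ) - 1 + 1 = b := by omega
      simp [matN, this]
    · intro c _ hc
      have : (c : ℕ) + 1 ≠ b := fun h' => hc (Fin.ext (by simp; omega))
      simp [matN, this]
    · simp
  · refine Finset.sum_eq_zero fun c _ => ?_
    have : (c : ℕ) + 1 ≠ b := by omega
    simp [matN, this]

theorem matE_mul_apply {n : ℕ} (A : Matrix (Fin n) (Fin n) (Cinf Fq)) (a b : Fin n) :
    (matE (Fq := Fq) n * A) a b = if (a : ℕ) + 1 = n then A ⟨0, a.pos⟩ b else 0 := by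
  rw [Matrix.mul_apply, Finset.sum_eq_single ⟨0, a.pos⟩]
  · simp [matE]
  · intro c _ hc
    have : (c : ℕ) ≠ 0 := fun h' => hc (Fin.ext h')
    simp [matE, this]
  · simp

theorem matN_mulVec_apply {n : ℕ} (v : Fin n → Cinf Fq) (a : Fin n) :
    (matN (Fq := Fq) n *ᵥ v) a = if h : (a : ℕ) + 1 < n then v ⟨a + 1, h⟩ else 0 := by
  -- The vector is read as the square matrix all of whose columns equal it.
  exact matN_mul_apply (Matrix.of fun i _ => v i) a a

theorem matE_mulVec_apply {n : ℕ} (v : Fin n → Cinf Fq) (a : Fin n) :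
    (matE (Fq := Fq) n *ᵥ v) a = if (a : ℕ) + 1 = n then v ⟨0, a.pos⟩ else 0 := by
  exact matE_mul_apply (Matrix.of fun i _ => v i) a a

theorem matD_mulVec_apply {n : ℕ} (v : Fin n → Cinf Fq) (a : Fin n) :
    (matD (Fq := Fq) n *ᵥ v) a = theta Fq * v a + if h : (a : ℕ) + 1 < n then v ⟨a + 1, h⟩ else 0 := by
  rw [matD, Matrix.add_mulVec, Pi.add_apply, matN_mulVec_apply, Matrix.smul_mulVec,
    Matrix.one_mulVec, Pi.smul_apply, smul_eq_mul]

variable (Fq) in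
/-- The roots of `∏_{1 ≤ j ≤ i} (t - θ^{q^j})^n`. -/
def expRoots (n i : ℕ) : Multiset (Cinf Fq) :=
  ∑ j ∈ Finset.range i, Multiset.replicate n (thetaConj Fq (j + 1))

theorem mem_expRoots {n i : ℕ} {y : Cinf Fq} (h : y ∈ expRoots Fq n i) :
    ∃ j < i, y = thetaConj Fq (j + 1) := by
  obtain ⟨j, hj, h⟩ := Multiset.mem_sum.1 h
  exact ⟨j, Finset.mem_range.1 hj, Multiset.eq_of_mem_replicate h⟩

theorem card_expRoots (n i : ℕ) : (expRoots Fq n i).card = i * n := by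
  simp [expRoots]

theorem expRoots_succ (n i : ℕ) :
    expRoots Fq n (i + 1) = expRoots Fq n i + Multiset.replicate n (thetaConj Fq (i + 1)) :=
  Finset.sum_range_succ _ _

variable (Fq) in
/-- The roots of `(t - θ)^l ∏_{1 ≤ j ≤ i} (t - θ^{q^j})^n`. -/
def denomRoots (n l i : ℕ) : Multiset (Cinf Fq) :=
  Multiset.replicate l (theta Fq) + expRoots Fq n i

theorem mem_denomRoots {n l i : ℕ} {y : Cinf Fq} (h : y ∈ denomRoots Fq n l i) :
    ∃ j ≤ i, y = thetaConj Fq j := by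
  rcases Multiset.mem_add.1 h with h | h
  · exact ⟨0, i.zero_le, (Multiset.eq_of_mem_replicate h).trans thetaConj_zero.symm⟩
  · obtain ⟨j, hj, h⟩ := mem_expRoots h
    exact ⟨j + 1, hj, h⟩

theorem card_denomRoots (n l i : ℕ) : (denomRoots Fq n l i).card = l + i * n := by
  simp [denomRoots, card_expRoots]

theorem denomRoots_succ_left (n l i : ℕ) :
    denomRoots Fq n (l + 1) i = theta Fq ::ₘ denomRoots Fq n l i := by
  rw [denomRoots, Multiset.replicate_succ, Multiset.cons_add, denomRoots]

theorem denomRoots_succ_right (n l i : ℕ) :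
    denomRoots Fq n l (i + 1) =
      Multiset.replicate n (thetaConj Fq (i + 1)) + denomRoots Fq n l i := by
  rw [denomRoots, expRoots_succ, denomRoots]
  abel

/-- Frobenius sends each conjugate to the next, so the n copies of θ become copies of θ^q and no
factor t - θ remains. This produces the Eτ term in the recursion for the exponential. -/
theorem map_frobenius_denomRoots (n i : ℕ) :
    (denomRoots Fq n n i).map (FiniteField.frobeniusAlgHom Fq (Cinf Fq)).toRingHom =
      denomRoots Fq n 0 (i + 1) := by
  have h : ∀ j, (FiniteField.frobeniusAlgHom Fq (Cinf Fq)).toRingHom (thetaConj Fq j) =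
      thetaConj Fq (j + 1) := fun j => by simp [thetaConj_succ]
  rw [denomRoots, denomRoots, expRoots, expRoots, Finset.sum_range_succ', ← thetaConj_zero,
    Multiset.map_add, Multiset.map_replicate, h, ← Multiset.coe_mapAddMonoidHom, map_sum]
  simp only [Multiset.coe_mapAddMonoidHom, Multiset.map_replicate, h]
  rw [Multiset.replicate_zero, zero_add, zero_add, add_comm]

/-- The conjugates of θ are distinct, so the last one is a root of multiplicity exactly n. -/
theorem residue_denomRoots_eq_zero (n l i : ℕ) (g : Polynomial (Cinf Fq)) :
    residue (thetaConj Fq (i + 1)) (rootPoly (denomRoots Fq n l (i + 1)))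
      ((Polynomial.X - Polynomial.C (thetaConj Fq (i + 1))) ^ n * g) = 0 := by
  rw [denomRoots_succ_right, rootPoly_add, rootPoly_replicate, residue_mul_mul_left _ _ _
    (pow_ne_zero _ (Polynomial.X_sub_C_ne_zero _))]
  refine residue_eq_zero_of_eval_ne_zero _ (rootPoly_eval_ne_zero fun h => ?_) _
  obtain ⟨j, hj, h⟩ := mem_denomRoots h
  have := thetaConj_injective h
  omega

/-- The coefficients of the exponential are residues. -/
theorem expCoeff_apply (n i : ℕ) (a b : Fin n) :
    expCoeff (Fq := Fq) n i a b = residue (thetaConj Fq i) (rootPoly (denomRoots Fq n (n - a) i))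
      ((Polynomial.X - Polynomial.C (thetaConj Fq i)) ^ (n - 1 - b)) := by
  let α : ℕ → Matrix (Fin n) (Fin n) (Cinf Fq) := fun i => Matrix.of fun a b =>
    residue (thetaConj Fq i) (rootPoly (denomRoots Fq n (n - a) i))
      ((Polynomial.X - Polynomial.C (thetaConj Fq i)) ^ (n - 1 - b))
  suffices h : IsExpSeries α by
    rw [(existsUnique_isExpSeries n).unique (isExpSeries_expCoeff n) h]
    rfl
  refine ⟨?_, fun i => ?_⟩
  · ext a b
    simp only [α, Matrix.of_apply, denomRoots, expRoots, Finset.range_zero, Finset.sum_empty,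
      add_zero, rootPoly_replicate, thetaConj_zero, residue_X_sub_C_pow, Matrix.one_apply]
    congr 1
    rw [Fin.ext_iff, eq_iff_iff]
    omega
  · rw [frobMat_matD, matD, mul_add, add_mul, mul_smul_comm, smul_mul_assoc, mul_one, one_mul]
    ext a b
    rw [Matrix.add_apply, Matrix.add_apply, Matrix.add_apply, mul_matN_apply, matN_mul_apply,
      matE_mul_apply, Matrix.smul_apply, Matrix.smul_apply, smul_eq_mul, smul_eq_mul]
    set x := thetaConj Fq (i + 1) with hx
    set g : Polynomial (Cinf Fq) := (Polynomial.X - Polynomial.C x) ^ (n - 1 - (b : ℕ)) with hg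
    set R := residue x (rootPoly (denomRoots Fq n (n - a) (i + 1))) with hR
    -- The numerator is multiplied by t in two ways. Writing t = x + (t - x) gives right
    -- multiplication by the twisted θI + N; writing t = θ + (t - θ) gives θ times the entry plus a
    -- residue with one factor t - θ fewer.
    have hl : theta Fq ^ Fintype.card Fq ^ (i + 1) * α (i + 1) a b +
        (if 0 < (b : ℕ) then α (i + 1) a ⟨b - 1, by omega⟩ else 0) = R (Polynomial.X * g) := by
      have h1 : Polynomial.X * g =
          Polynomial.C x * g + (Polynomial.X - Polynomial.C x) ^ (n - 1 - (b : ℕ) + 1) := by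
        rw [hg]; ring
      rw [h1, hR, residue_add, residue_C_mul]
      congr 1
      split_ifs with h
      · change residue _ _ _ = _
        congr 2
        simp only
        omega
      -- Here b = 0, and the exponent reaches n, which removes the pole at x.
      · have := residue_denomRoots_eq_zero (Fq := Fq) n (n - a) i 1
        rw [mul_one] at this
        rw [show n - 1 - (b : ℕ) + 1 = n by omega, this]
    have hr : R (Polynomial.X * g) = theta Fq * α (i + 1) a b +
        residue x (rootPoly (denomRoots Fq n (n - 1 - a) (i + 1))) g := by
      have h1 : Polynomial.X * g = Polynomial.C (theta Fq) * g +
          (Polynomial.X - Polynomial.C (theta Fq)) * g := by ring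
      rw [h1, hR, residue_add, residue_C_mul]
      congr 1
      rw [show n - (a : ℕ) = n - 1 - a + 1 by omega, denomRoots_succ_left, residue_rootPoly_cons]
    rw [hl, hr, add_assoc]
    congr 1
    by_cases h : (a : ℕ) + 1 < n
    · rw [dif_pos h, if_neg h.ne, add_zero]
      change _ = residue _ _ _
      congr 3
      simp only
      omega
    -- In the bottom row no factor t - θ is left, and the residue is the Frobenius image of the
    -- top-row entry of the previous coefficient.
    · have ha : (a : ℕ) + 1 = n := by omega
      rw [dif_neg h, if_pos ha, zero_add, show n - 1 - (a : ℕ) = 0 by omega]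
      change _ = residue (K := Cinf Fq) _ _ _ ^ Fintype.card Fq ^ 1
      have := residue_map (FiniteField.frobeniusAlgHom Fq (Cinf Fq)).toRingHom (thetaConj Fq i)
        (rootPoly (denomRoots Fq n n i))
        ((Polynomial.X - Polynomial.C (thetaConj Fq i)) ^ (n - 1 - (b : ℕ)))
      rw [rootPoly_map, map_frobenius_denomRoots] at this
      simpa [← thetaConj_succ] using this

/-! ### Residues of restricted power series -/

section ResidueSum

variable {K : Type*} [NormedField K]

theorem IsRestricted.mono {r s : ℝ} (hr : 0 ≤ r) (h : r ≤ s) {f : K⟦X⟧}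
    (hf : IsRestricted s f) : IsRestricted r f := by
  rw [isRestricted_iff'] at hf ⊢
  refine squeeze_zero (fun k => by positivity) (fun k => ?_) hf
  exact mul_le_mul_of_nonneg_left (pow_le_pow_left₀ hr h k) (norm_nonneg _)

theorem IsRestricted.exists_bound {r : ℝ} {f : K⟦X⟧} (hf : IsRestricted r f) :
    ∃ c : ℝ, ∀ k, ‖coeff k f‖ * r ^ k ≤ c := by
  obtain ⟨c, hc⟩ := ((isRestricted_iff' r f).1 hf).bddAbove_range
  exact ⟨c, fun k => hc ⟨k, rfl⟩⟩

theorem isRestricted_X (r : ℝ) : IsRestricted r (X : K⟦X⟧) := isRestricted_monomial r 1 1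

/-- The residue at `x` of `f / P`, for a power series `f` converging on `|t| ≤ |x|`. -/
def residueSum (x : K) (P : Polynomial K) (f : K⟦X⟧) : K :=
  ∑' k : ℕ, coeff k f * residue x P (Polynomial.X ^ k)

theorem residueSum_C_mul (x : K) (P : Polynomial K) (a : K) (f : K⟦X⟧) :
    residueSum x P (C a * f) = a * residueSum x P f := by
  rw [residueSum, residueSum, ← tsum_mul_left]
  simp only [coeff_C_mul, mul_assoc]

theorem residueSum_eq_zero_of_eval_ne_zero (x : K) {P : Polynomial K} (hP : P.eval x ≠ 0)
    (f : K⟦X⟧) : residueSum x P f = 0 := by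
  simp [residueSum, residue_eq_zero_of_eval_ne_zero x hP]

variable [IsUltrametricDist K]

theorem IsRestricted.sub {r : ℝ} {f g : K⟦X⟧} (hf : IsRestricted r f) (hg : IsRestricted r g) :
    IsRestricted r (f - g) :=
  (IsRestricted.subring r).sub_mem hf hg

theorem IsRestricted.pow {r : ℝ} {f : K⟦X⟧} (hf : IsRestricted r f) (n : ℕ) :
    IsRestricted r (f ^ n) :=
  (IsRestricted.subring r).pow_mem hf n

theorem isRestricted_X_sub_C (r : ℝ) (y : K) : IsRestricted r (X - C y : K⟦X⟧) :=
  IsRestricted.sub (isRestricted_X r) (isRestricted_C r y)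

variable [CompleteSpace K]

theorem summable_residueSum {x : K} (hx : 1 ≤ ‖x‖) (P : Polynomial K) {f : K⟦X⟧}
    (hf : IsRestricted ‖x‖ f) :
    Summable fun k : ℕ => coeff k f * residue x P (Polynomial.X ^ k) := by
  obtain ⟨c, hc, h⟩ := exists_norm_residue_X_pow_le hx P
  refine NonarchimedeanAddGroup.summable_of_tendsto_cofinite_zero ?_
  rw [isRestricted_iff] at hf
  refine squeeze_zero_norm (fun k => ?_) (by simpa using hf.const_mul c)
  rw [norm_mul]
  refine (mul_le_mul_of_nonneg_left (h k) (norm_nonneg _)).trans_eq ?_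
  ring

theorem hasSum_residueSum {x : K} (hx : 1 ≤ ‖x‖) (P : Polynomial K) {f : K⟦X⟧}
    (hf : IsRestricted ‖x‖ f) :
    HasSum (fun k : ℕ => coeff k f * residue x P (Polynomial.X ^ k)) (residueSum x P f) :=
  (summable_residueSum hx P hf).hasSum

theorem residueSum_add {x : K} (hx : 1 ≤ ‖x‖) (P : Polynomial K) {f g : K⟦X⟧}
    (hf : IsRestricted ‖x‖ f) (hg : IsRestricted ‖x‖ g) :
    residueSum x P (f + g) = residueSum x P f + residueSum x P g := by
  rw [residueSum, residueSum, residueSum,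
    ← (summable_residueSum hx P hf).tsum_add (summable_residueSum hx P hg)]
  simp only [map_add, add_mul]

/-- Cancellation of t - y carries over from polynomials to series by splitting t·t^k = (t - y) t^k +
y t^k in every term. -/
theorem residueSum_rootPoly_cons {x : K} (hx : 1 ≤ ‖x‖) (y : K) (M : Multiset K) {f : K⟦X⟧}
    (hf : IsRestricted ‖x‖ f) :
    residueSum x (rootPoly (y ::ₘ M)) ((X - C y) * f) = residueSum x (rootPoly M) f := by
  have h1 := summable_residueSum hx (rootPoly (y ::ₘ M))
    (isRestricted.mul _ (isRestricted_X ‖x‖) hf)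
  have h2 := hasSum_residueSum hx (rootPoly (y ::ₘ M)) hf
  have h3 := hasSum_residueSum hx (rootPoly M) hf
  have hX : residueSum x (rootPoly (y ::ₘ M)) (X * f) =
      residueSum x (rootPoly M) f + y * residueSum x (rootPoly (y ::ₘ M)) f := by
    rw [residueSum, h1.tsum_eq_zero_add, coeff_zero_X_mul, zero_mul, zero_add]
    refine HasSum.tsum_eq ?_
    refine (h3.add (h2.mul_left y)).congr_fun fun k => ?_
    rw [coeff_succ_X_mul, ← residue_rootPoly_cons x y M, sub_mul, residue_sub, residue_C_mul,
      pow_succ']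
    ring
  have h : X * f = (X - C y) * f + C y * f := by ring
  rw [h, residueSum_add hx _ (isRestricted.mul _ (isRestricted_X_sub_C _ y) hf)
    (isRestricted.mul _ (isRestricted_C _ y) hf), residueSum_C_mul] at hX
  exact add_right_cancel hX

theorem residueSum_rootPoly_replicate_add {x : K} (hx : 1 ≤ ‖x‖) (y : K) (M : Multiset K)
    {f : K⟦X⟧} (hf : IsRestricted ‖x‖ f) (n : ℕ) :
    residueSum x (rootPoly (Multiset.replicate n y + M)) ((X - C y) ^ n * f) =
      residueSum x (rootPoly M) f := by
  induction n with
  | zero => simp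
  | succ n ih =>
    rw [Multiset.replicate_succ, Multiset.cons_add, pow_succ', mul_assoc,
      residueSum_rootPoly_cons hx _ _
        (isRestricted.mul _ (IsRestricted.pow (isRestricted_X_sub_C _ y) n) hf), ih]

/-- An ultrametric residue theorem: all residues in the disc together are at most r times the size
of f/P on its boundary. The sum over poles is taken before estimating each monomial, since only the
total is this small. -/
theorem norm_sum_residueSum_le (S : Finset K) {r d : ℝ} (hr : 0 < r)
    (hS : ∀ x ∈ S, 1 ≤ ‖x‖ ∧ ‖x‖ ≤ r) {M : Multiset K} (hM : ∀ y ∈ M, y ∈ S) {f : K⟦X⟧}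
    (hf : IsRestricted r f) (hd : ∀ k, ‖coeff k f‖ * r ^ k ≤ d) :
    ‖∑ x ∈ S, residueSum x (rootPoly M) f‖ ≤ d * r / r ^ M.card := by
  have hd0 : 0 ≤ d := le_trans (by positivity) (hd 0)
  simp only [residueSum]
  rw [← Summable.tsum_finsetSum fun x hx => summable_residueSum (hS x hx).1 _
    (IsRestricted.mono (norm_nonneg x) (hS x hx).2 hf)]
  refine IsUltrametricDist.norm_tsum_le_of_forall_le_of_nonneg (by positivity) fun k => ?_
  rw [← Finset.mul_sum, norm_mul, le_div_iff₀ (by positivity), mul_assoc]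
  refine (mul_le_mul_of_nonneg_left (norm_sum_residue_rootPoly_le S hr.le k M fun y hy =>
    ⟨hM y hy, (hS y (hM y hy)).2⟩) (norm_nonneg _)).trans ?_
  rw [pow_succ, ← mul_assoc]
  exact mul_le_mul_of_nonneg_right (hd k) hr.le

end ResidueSum

/-! ### Expansions at `θ` -/

theorem one_le_norm_theta : 1 ≤ ‖theta Fq‖ := by
  rw [norm_theta]
  exact (one_lt_card_real Fq).le

theorem thetaCoeff_eq_residueSum (f : (Cinf Fq)⟦X⟧) (j : ℕ) :
    thetaCoeff f j =
      residueSum (theta Fq) (rootPoly (Multiset.replicate (j + 1) (theta Fq))) f := by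
  rw [thetaCoeff, residueSum]
  refine tsum_congr fun k => ?_
  rw [rootPoly_replicate, residue_X_sub_C_pow_X_pow]
  ring

theorem delta_apply (n : ℕ) (f : (Cinf Fq)⟦X⟧) (a : Fin n) :
    delta n f a =
      residueSum (theta Fq) (rootPoly (Multiset.replicate (n - a) (theta Fq))) f := by
  rw [delta, thetaCoeff_eq_residueSum, show n - 1 - (a : ℕ) + 1 = n - a by omega]

theorem delta_add (n : ℕ) {f g : (Cinf Fq)⟦X⟧} (hf : IsRestricted (Fintype.card Fq : ℝ) f)
    (hg : IsRestricted (Fintype.card Fq : ℝ) g) : delta n (f + g) = delta n f + delta n g := by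
  rw [← norm_theta] at hf hg
  funext a
  rw [Pi.add_apply, delta_apply, delta_apply, delta_apply, residueSum_add one_le_norm_theta _ hf hg]

/-- With t = θ + (t - θ), the factor t - θ shifts the expansion at θ by one place, which is the
action of N. -/
theorem delta_X_mul (n : ℕ) {f : (Cinf Fq)⟦X⟧} (hf : IsRestricted (Fintype.card Fq : ℝ) f) :
    delta n (X * f) = matD n *ᵥ delta n f := by
  rw [← norm_theta] at hf
  funext a
  have h : X * f = C (theta Fq) * f + (X - C (theta Fq)) * f := by ring
  rw [matD_mulVec_apply, delta_apply, h, residueSum_add one_le_norm_theta _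
    (isRestricted.mul _ (isRestricted_C _ _) hf) (isRestricted.mul _ (isRestricted_X_sub_C _ _) hf),
    residueSum_C_mul, delta_apply]
  congr 1
  have h1 : n - (a : ℕ) = n - (a + 1) + 1 := by omega
  rw [h1, Multiset.replicate_succ, residueSum_rootPoly_cons one_le_norm_theta _ _ hf]
  split_ifs with h2
  · rw [delta_apply]
  -- In the last coordinate the factor t - θ removes the simple pole.
  · rw [show n - ((a : ℕ) + 1) = 0 by omega]
    exact residueSum_eq_zero_of_eval_ne_zero _ (by simp [rootPoly]) _

theorem delta_X_sub_C_pow_mul (n : ℕ) {f : (Cinf Fq)⟦X⟧}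
    (hf : IsRestricted (Fintype.card Fq : ℝ) f) :
    delta n ((X - C (theta Fq)) ^ n * f) = 0 := by
  rw [← norm_theta] at hf
  funext a
  have h : (X - C (theta Fq)) ^ n * f =
      (X - C (theta Fq)) ^ (n - (a : ℕ)) * ((X - C (theta Fq)) ^ (a : ℕ) * f) := by
    rw [← mul_assoc, ← pow_add, Nat.sub_add_cancel a.is_lt.le]
  have := residueSum_rootPoly_replicate_add one_le_norm_theta (theta Fq) 0
    (isRestricted.mul _ (IsRestricted.pow (isRestricted_X_sub_C _ (theta Fq)) a) hf) (n - a)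
  rw [add_zero] at this
  rw [delta_apply, h, this]
  exact residueSum_eq_zero_of_eval_ne_zero _ (by simp [rootPoly]) _

/-! ### Solutions of the difference equation give periods -/

theorem coeff_iterate_twist (m k : ℕ) (f : (Cinf Fq)⟦X⟧) :
    coeff k ((twist Fq)^[m] f) = coeff k f ^ Fintype.card Fq ^ m := by
  induction m generalizing f with
  | zero => simp
  | succ m ih =>
    rw [Function.iterate_succ_apply, ih, twist, PowerSeries.coeff_map]
    simp [← pow_mul, pow_succ']

/-- The terms satisfy |a_k^{q^m}| (r^{q^m})^k = (|a_k| r^k)^{q^m}. For r = q the m-th twist thus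
converges on a disc containing θ^{q^j} for every j ≤ m. -/
theorem isRestricted_iterate_twist {r : ℝ} {f : (Cinf Fq)⟦X⟧} (hf : IsRestricted r f) (m : ℕ) :
    IsRestricted (r ^ Fintype.card Fq ^ m) ((twist Fq)^[m] f) := by
  rw [isRestricted_iff'] at hf ⊢
  have h := hf.pow (Fintype.card Fq ^ m)
  rw [zero_pow (pow_ne_zero _ Fintype.card_ne_zero)] at h
  refine h.congr fun k => ?_
  rw [coeff_iterate_twist, norm_pow, mul_pow, ← pow_mul, ← pow_mul, mul_comm k]

theorem isRestricted_iterate_twist_thetaConj {f : (Cinf Fq)⟦X⟧}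
    (hf : IsRestricted (Fintype.card Fq : ℝ) f) (m : ℕ) :
    IsRestricted ‖thetaConj Fq m‖ ((twist Fq)^[m] f) := by
  rw [norm_thetaConj]
  exact isRestricted_iterate_twist hf m

theorem twist_X_sub_C (y : Cinf Fq) :
    twist Fq (X - C y) = X - C (y ^ Fintype.card Fq) := by
  simp [twist]

theorem twist_C (y : Cinf Fq) : twist Fq (C y) = C (y ^ Fintype.card Fq) := by
  simp [twist]

theorem iterate_twist_succ {n : ℕ} {f : (Cinf Fq)⟦X⟧}
    (hf : twist Fq f = (X - C (thetaConj Fq 1)) ^ n * f) (m : ℕ) :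
    (twist Fq)^[m + 1] f = (X - C (thetaConj Fq (m + 1))) ^ n * (twist Fq)^[m] f := by
  induction m with
  | zero => simpa using hf
  | succ m ih =>
    rw [Function.iterate_succ_apply', ih, map_mul, map_pow, twist_X_sub_C, ← thetaConj_succ,
      ← Function.iterate_succ_apply' (twist Fq)]
    rw [ih]

/-- The terms of the exponential series at `δ₀ⁿ(f)` are residues. -/
theorem expCoeff_mulVec_frobVec_delta (n i : ℕ) {f : (Cinf Fq)⟦X⟧}
    (hf : IsRestricted (Fintype.card Fq : ℝ) f) (a : Fin n) :
    (expCoeff n i *ᵥ frobVec i (delta n f)) a =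
      residueSum (thetaConj Fq i) (rootPoly (denomRoots Fq n (n - a) i)) ((twist Fq)^[i] f) := by
  obtain ⟨φ, hφ⟩ := exists_frobHom (Fq := Fq) i
  have hφc : Continuous φ := by
    rw [show (φ : Cinf Fq → Cinf Fq) = fun x => x ^ Fintype.card Fq ^ i from funext hφ]
    exact continuous_pow _
  have h0 : ∀ b : Fin n, HasSum (fun k => coeff k ((twist Fq)^[i] f) *
      ((k.choose (n - 1 - b) : Cinf Fq) * thetaConj Fq i ^ (k - (n - 1 - (b : ℕ)))))
      (frobVec i (delta n f) b) := by
    intro b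
    have h := hasSum_residueSum one_le_norm_theta
      (rootPoly (Multiset.replicate (n - 1 - b + 1) (theta Fq))) (by rwa [norm_theta])
    rw [← thetaCoeff_eq_residueSum] at h
    have h' := h.map φ hφc
    rw [hφ] at h'
    refine h'.congr_fun ?_
    intro k
    rw [Function.comp_apply, rootPoly_replicate, residue_X_sub_C_pow_X_pow, map_mul, hφ (coeff k f),
      coeff_iterate_twist, map_mul, map_natCast, map_pow, hφ, thetaConj]
  have h1 := hasSum_sum (s := Finset.univ) fun b _ => (h0 b).mul_left (expCoeff n i a b)
  refine h1.unique ((hasSum_residueSum (one_le_norm_thetaConj i)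
    (rootPoly (denomRoots Fq n (n - a) i))
    (isRestricted_iterate_twist_thetaConj hf i)).congr_fun fun k => ?_)
  -- The pole at θ^{q^i} has order at most n, so only the residues appearing in `expCoeff_apply`
  -- contribute.
  have hz : ∀ j ≥ n, residue (thetaConj Fq i) (rootPoly (denomRoots Fq n (n - a) i))
      ((Polynomial.X - Polynomial.C (thetaConj Fq i)) ^ j) = 0 := by
    intro j hj
    obtain ⟨j, rfl⟩ := Nat.exists_eq_add_of_le hj
    cases i with
    | zero =>
      rw [denomRoots, expRoots, Finset.sum_range_zero, add_zero, rootPoly_replicate,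
        thetaConj_zero, residue_X_sub_C_pow, if_neg (by omega)]
    | succ i => rw [pow_add, residue_denomRoots_eq_zero]
  symm
  -- The reflection is needed because coordinate b belongs to the exponent n - 1 - b.
  rw [residue_X_pow_of_le _ hz, ← Finset.sum_range_reflect, Finset.sum_range, Finset.mul_sum]
  refine Finset.sum_congr rfl fun b _ => ?_
  rw [expCoeff_apply]
  ring

/-- The factor (t - θ^{q^{m+1}})^n gained by the numerator under twisting cancels the one gained by
the denominator. All terms of the exponential series up to m thereby become residues of a single
quotient. -/
theorem residueSum_iterate_twist {n : ℕ} {f : (Cinf Fq)⟦X⟧}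
    (hf : IsRestricted (Fintype.card Fq : ℝ) f)
    (hf' : twist Fq f = (X - C (thetaConj Fq 1)) ^ n * f) (l : ℕ) {i m : ℕ} (h : i ≤ m) :
    residueSum (thetaConj Fq i) (rootPoly (denomRoots Fq n l m)) ((twist Fq)^[m] f) =
      residueSum (thetaConj Fq i) (rootPoly (denomRoots Fq n l i)) ((twist Fq)^[i] f) := by
  induction m, h using Nat.le_induction with
  | base => rfl
  | succ m h ih =>
    rw [iterate_twist_succ hf', denomRoots_succ_right, residueSum_rootPoly_replicate_add
      (one_le_norm_thetaConj i) _ _ (IsRestricted.mono (norm_nonneg _)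
        (norm_thetaConj_strictMono.monotone h) (isRestricted_iterate_twist_thetaConj hf m)), ih]

theorem tendsto_div_pow_pow_atTop {q : ℕ} (hq : 1 < q) (c : ℝ) (hc : 0 ≤ c) :
    Tendsto (fun m : ℕ => (c / (q : ℝ) ^ m) ^ q ^ m) atTop (𝓝 0) := by
  have hq' : (1 : ℝ) < q := by exact_mod_cast hq
  have h1 : Tendsto (fun m : ℕ => c / (q : ℝ) ^ m) atTop (𝓝 0) :=
    (tendsto_pow_atTop_atTop_of_one_lt hq').const_div_atTop c
  refine squeeze_zero' (Eventually.of_forall fun m => by positivity) ?_ h1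
  filter_upwards [h1.eventually_le_const one_pos] with m hm
  exact pow_le_of_le_one (by positivity) hm (pow_ne_zero _ (by omega))

/-- A partial sum of the exponential series is the total residue of one quotient, whose denominator
has degree growing linearly in m; this beats the growth of the twists of f. -/
theorem delta_mem_Lambda {n : ℕ} (hn : 1 ≤ n) {f : (Cinf Fq)⟦X⟧}
    (hf : IsRestricted (Fintype.card Fq : ℝ) f)
    (hf' : twist Fq f = (X - C (thetaConj Fq 1)) ^ n * f) : delta n f ∈ Lambda Fq n := by
  change HasSum (fun i => expCoeff n i *ᵥ frobVec i (delta n f)) 0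
  rw [Pi.hasSum]
  intro a
  rw [Pi.zero_apply]
  set v := fun i => (expCoeff n i *ᵥ frobVec i (delta n f)) a with hv
  have hq := one_lt_card_real Fq
  obtain ⟨c, hc⟩ := IsRestricted.exists_bound hf
  have hc0 : 0 ≤ c := le_trans (by positivity) (hc 0)
  -- On the radius R = q^{q^m} the m-th twist has size at most c^{q^m}. The denominator has degree n
  -- - a + mn ≥ m + 1, and R/R^(m+1) = (q^{-m})^{q^m}.
  have hbound : ∀ m, ‖∑ i ∈ Finset.range (m + 1), v i‖ ≤
      (c / (Fintype.card Fq : ℝ) ^ m) ^ Fintype.card Fq ^ m := by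
    intro m
    have h1 : ∑ i ∈ Finset.range (m + 1), v i =
        ∑ x ∈ (Finset.range (m + 1)).map ⟨thetaConj Fq, thetaConj_injective⟩,
          residueSum x (rootPoly (denomRoots Fq n (n - a) m)) ((twist Fq)^[m] f) := by
      rw [Finset.sum_map]
      refine Finset.sum_congr rfl fun i hi => ?_
      rw [Function.Embedding.coeFn_mk,
        residueSum_iterate_twist hf hf' _ (by simpa [Nat.lt_succ_iff] using hi)]
      exact expCoeff_mulVec_frobVec_delta n i hf a
    rw [h1]
    have hpos : 0 < ‖thetaConj Fq m‖ := one_pos.trans_le (one_le_norm_thetaConj m)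
    refine (norm_sum_residueSum_le _ (d := c ^ Fintype.card Fq ^ m) hpos ?_ ?_
      (isRestricted_iterate_twist_thetaConj hf m) ?_).trans ?_
    · intro x hx
      obtain ⟨i, hi, rfl⟩ := Finset.mem_map.1 hx
      exact ⟨one_le_norm_thetaConj i, norm_thetaConj_strictMono.monotone
        (by simpa [Nat.lt_succ_iff] using hi)⟩
    · intro y hy
      obtain ⟨j, hj, rfl⟩ := mem_denomRoots hy
      exact Finset.mem_map.2 ⟨j, by simpa [Nat.lt_succ_iff] using hj, rfl⟩
    · intro k
      rw [coeff_iterate_twist, norm_thetaConj, norm_pow, ← pow_mul, mul_comm _ k, pow_mul,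
        ← mul_pow]
      exact pow_le_pow_left₀ (by positivity) (hc k) _
    · rw [div_pow, ← pow_mul, mul_comm m, pow_mul, ← norm_thetaConj, mul_div_assoc,
        div_eq_mul_inv (c ^ _)]
      refine mul_le_mul_of_nonneg_left ?_ (by positivity)
      rw [div_le_iff₀ (by positivity), ← div_eq_inv_mul, le_div_iff₀ (by positivity), ← pow_succ']
      refine pow_le_pow_right₀ (one_le_norm_thetaConj m) ?_
      rw [card_denomRoots]
      have := Nat.mul_le_mul_left m hn
      omega
  have hlim : Tendsto (fun m => ∑ i ∈ Finset.range m, v i) atTop (𝓝 0) := by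
    rw [← tendsto_add_atTop_iff_nat 1]
    exact squeeze_zero_norm hbound (tendsto_div_pow_pow_atTop Fintype.one_lt_card c hc0)
  -- In an ultrametric complete group, terms tending to 0 give unconditional summability, as
  -- `HasSum` requires.
  have hv0 : Tendsto v atTop (𝓝 0) := by
    have h := ((tendsto_add_atTop_iff_nat 1).2 hlim).sub hlim
    rw [sub_zero] at h
    refine h.congr fun m => ?_
    rw [Finset.sum_range_succ, add_sub_cancel_left]
  have hs : Summable v := NonarchimedeanAddGroup.summable_of_tendsto_cofinite_zero
    (by rwa [Nat.cofinite_eq_atTop])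
  have := hs.hasSum
  rwa [tendsto_nhds_unique this.tendsto_sum_nat hlim] at this

/-! ### Series with geometrically decreasing coefficients -/

section Geometric

variable {K : Type*} [NormedField K]

theorem isRestricted_of_norm_coeff_le {f : K⟦X⟧} {c ρ r : ℝ} (hρ : 0 ≤ ρ) (hr : 0 ≤ r)
    (h : ρ * r < 1) (hf : ∀ k, ‖coeff k f‖ ≤ c * ρ ^ k) : IsRestricted r f := by
  rw [isRestricted_iff']
  have hlim := (tendsto_pow_atTop_nhds_zero_of_lt_one (mul_nonneg hρ hr) h).const_mul c
  rw [mul_zero] at hlim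
  refine squeeze_zero (fun k => by positivity) (fun k => ?_) hlim
  rw [mul_pow, ← mul_assoc]
  exact mul_le_mul_of_nonneg_right (hf k) (by positivity)

/-- The recursion for the coefficients of the inverse preserves the geometric ratio, since an
ultrametric sum is no larger than its largest term. -/
theorem norm_coeff_inv_le [IsUltrametricDist K] {f : K⟦X⟧} (h0 : constantCoeff f ≠ 0) {ρ : ℝ}
    (hρ : 0 ≤ ρ) (hf : ∀ k, ‖coeff k f‖ ≤ ‖constantCoeff f‖ * ρ ^ k) (k : ℕ) :
    ‖coeff k f⁻¹‖ ≤ ‖constantCoeff f‖⁻¹ * ρ ^ k := by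
  have hpos : 0 < ‖constantCoeff f‖ := norm_pos_iff.2 h0
  induction k using Nat.strong_induction_on with
  | _ k ih =>
    rw [PowerSeries.coeff_inv]
    split_ifs with hk
    · simp [hk]
    · rw [norm_mul, norm_neg, norm_inv]
      refine mul_le_mul_of_nonneg_left ?_ (by positivity)
      refine IsUltrametricDist.norm_sum_le_of_forall_le_of_nonneg (by positivity) fun p hp => ?_
      split_ifs with hpk
      · rw [norm_mul]
        refine (mul_le_mul (hf _) (ih _ hpk) (norm_nonneg _) (by positivity)).trans_eq ?_
        rw [← Finset.HasAntidiagonal.mem_antidiagonal.1 hp, pow_add]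
        field_simp
      · simpa using pow_nonneg hρ k

end Geometric

/-! ### The function `Ω` -/

theorem constantCoeff_Omega (η : Cinf Fq) :
    constantCoeff (Omega η) = (η ^ Fintype.card Fq)⁻¹ := by
  have h := tendsto_coeff_omegaPartial η 0
  rw [← coeff_zero_eq_constantCoeff_apply]
  refine tendsto_nhds_unique h (tendsto_const_nhds.congr fun m => ?_)
  simp [omegaPartial, Finset.prod_eq_one]

/-- Every factor 1 - t/θ^{q^i} with i ≥ 1 has Gauss norm 1 at radius |θ^q|. -/
theorem norm_coeff_omegaPartial_le (η : Cinf Fq) (m k : ℕ) :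
    ‖coeff k (omegaPartial η m)‖ ≤
      ‖(η ^ Fintype.card Fq)⁻¹‖ * ‖thetaConj Fq 1‖⁻¹ ^ k := by
  induction m generalizing k with
  | zero =>
    simp only [omegaPartial, Finset.range_zero, Finset.prod_empty, mul_one, coeff_C]
    split_ifs with h
    · simp [h]
    · rw [norm_zero]
      positivity
  | succ m ih =>
    have hs : omegaPartial η (m + 1) = omegaPartial η m -
        C (thetaConj Fq (m + 1))⁻¹ * (X * omegaPartial η m) := by
      simp only [omegaPartial, Finset.prod_range_succ, thetaConj]
      ring
    rw [hs, map_sub, coeff_C_mul, sub_eq_add_neg]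
    refine (IsUltrametricDist.norm_add_le_max _ _).trans (max_le (ih k) ?_)
    rw [norm_neg, norm_mul, norm_inv]
    cases k with
    | zero => simp
    | succ k =>
      rw [coeff_succ_X_mul, pow_succ', mul_left_comm]
      refine mul_le_mul (inv_anti₀ (one_pos.trans_le (one_le_norm_thetaConj 1)) ?_) (ih k)
        (norm_nonneg _) (by positivity)
      exact norm_thetaConj_strictMono.monotone (Nat.le_add_left 1 m)

theorem norm_coeff_Omega_le (η : Cinf Fq) (k : ℕ) :
    ‖coeff k (Omega η)‖ ≤ ‖constantCoeff (Omega η)‖ * ‖thetaConj Fq 1‖⁻¹ ^ k := by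
  rw [constantCoeff_Omega]
  exact le_of_tendsto (tendsto_coeff_omegaPartial η k).norm
    (Eventually.of_forall fun m => norm_coeff_omegaPartial_le η m k)

/-- The gap between |θ^q| and q is what puts both Ω and its inverse in 𝕋_q. -/
theorem inv_norm_thetaConj_one_mul_lt :
    ‖thetaConj Fq 1‖⁻¹ * (Fintype.card Fq : ℝ) < 1 := by
  rw [inv_mul_lt_one₀ (one_pos.trans_le (one_le_norm_thetaConj 1)), ← norm_theta, ← thetaConj_zero]
  exact norm_thetaConj_strictMono one_pos

theorem isRestricted_Omega (η : Cinf Fq) : IsRestricted (Fintype.card Fq : ℝ) (Omega η) :=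
  isRestricted_of_norm_coeff_le (by positivity) (by positivity) inv_norm_thetaConj_one_mul_lt
    (norm_coeff_Omega_le η)

theorem isRestricted_inv_Omega {η : Cinf Fq} (hη : η ≠ 0) :
    IsRestricted (Fintype.card Fq : ℝ) (Omega η)⁻¹ := by
  refine isRestricted_of_norm_coeff_le (by positivity) (by positivity)
    inv_norm_thetaConj_one_mul_lt
    (norm_coeff_inv_le ?_ (by positivity) (norm_coeff_Omega_le η))
  rw [constantCoeff_Omega]
  exact inv_ne_zero (pow_ne_zero _ hη)

theorem Omega_ne_zero {η : Cinf Fq} (hη : η ≠ 0) : Omega η ≠ 0 := by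
  intro h
  have := constantCoeff_Omega η
  rw [h, map_zero] at this
  exact inv_ne_zero (pow_ne_zero _ hη) this.symm

theorem Omega_pow_mul_inv_pow {η : Cinf Fq} (hη : η ≠ 0) (n : ℕ) :
    Omega η ^ n * (Omega η)⁻¹ ^ n = 1 := by
  rw [← mul_pow, PowerSeries.mul_inv_cancel _ ?_, one_pow]
  rw [constantCoeff_Omega]
  exact inv_ne_zero (pow_ne_zero _ hη)

/-- Twisting moves each factor to the next one, leaving the factor 1 - t/θ^q. It becomes t - θ^q
once constants are compared, using (η^q)^q = -θ^q η^q, a consequence of η^(q-1) = -θ. -/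
theorem omegaPartial_succ_eq {η : Cinf Fq} (hη : η ^ (Fintype.card Fq - 1) = -theta Fq) (m : ℕ) :
    omegaPartial η (m + 1) = (X - C (thetaConj Fq 1)) * twist Fq (omegaPartial η m) := by
  have h0 : theta Fq ≠ 0 := norm_pos_iff.1 (one_pos.trans_le one_le_norm_theta)
  have hη0 : η ≠ 0 := by
    rintro rfl
    rw [zero_pow (Nat.sub_ne_zero_of_lt Fintype.one_lt_card)] at hη
    exact h0 (neg_eq_zero.1 hη.symm)
  have hc : η ^ Fintype.card Fq = -theta Fq * η := by
    rw [← hη, ← pow_succ, Nat.sub_add_cancel Fintype.card_pos]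
  have hneg : (-theta Fq) ^ Fintype.card Fq = -thetaConj Fq 1 := by
    have := map_neg (FiniteField.frobeniusAlgHom Fq (Cinf Fq)) (theta Fq)
    simpa [thetaConj] using this
  have hcc : (η ^ Fintype.card Fq) ^ Fintype.card Fq = -thetaConj Fq 1 * η ^ Fintype.card Fq := by
    nth_rewrite 1 [hc]
    rw [mul_pow, hneg]
  have h1 : thetaConj Fq 1 ≠ 0 := pow_ne_zero _ h0
  have hu : η ^ Fintype.card Fq ≠ 0 := pow_ne_zero _ hη0
  simp only [omegaPartial]
  rw [Finset.prod_range_succ', map_mul, map_prod, twist_C, inv_pow, hcc]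
  have hprod : ∀ i ∈ Finset.range m, twist Fq (1 - C (theta Fq ^ Fintype.card Fq ^ (i + 1))⁻¹ * X) =
      1 - C (theta Fq ^ Fintype.card Fq ^ (i + 1 + 1))⁻¹ * X := by
    intro i _
    rw [map_sub, map_one, map_mul, twist_C, inv_pow, ← pow_mul, ← pow_succ]
    simp [twist]
  rw [Finset.prod_congr rfl hprod]
  have hC : C (η ^ Fintype.card Fq)⁻¹ * (1 - C (theta Fq ^ Fintype.card Fq ^ (0 + 1))⁻¹ * X) =
      (X - C (thetaConj Fq 1)) * C (-thetaConj Fq 1 * η ^ Fintype.card Fq)⁻¹ := by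
    have e1 : (η ^ Fintype.card Fq)⁻¹ =
        -thetaConj Fq 1 * (-thetaConj Fq 1 * η ^ Fintype.card Fq)⁻¹ := by
      field_simp
    have e2 : (η ^ Fintype.card Fq)⁻¹ * (theta Fq ^ Fintype.card Fq ^ (0 + 1))⁻¹ =
        -(-thetaConj Fq 1 * η ^ Fintype.card Fq)⁻¹ := by
      change _ * (thetaConj Fq 1)⁻¹ = _
      field_simp
    rw [mul_sub, mul_one, ← mul_assoc, ← map_mul, e2, e1]
    simp only [map_mul, map_neg]
    ring
  rw [mul_comm (∏ i ∈ _, _), ← mul_assoc, hC, mul_assoc]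

/-- The functional equation of `Ω`. -/
theorem Omega_eq {η : Cinf Fq} (hη : η ^ (Fintype.card Fq - 1) = -theta Fq) :
    Omega η = (X - C (thetaConj Fq 1)) * twist Fq (Omega η) := by
  have htw : ∀ k, Tendsto (fun m => coeff k (twist Fq (omegaPartial η m))) atTop
      (𝓝 (coeff k (twist Fq (Omega η)))) := by
    intro k
    have h := (tendsto_coeff_omegaPartial η k).pow (Fintype.card Fq)
    simpa [twist] using h
  ext k
  refine tendsto_nhds_unique
    ((tendsto_add_atTop_iff_nat 1).2 (tendsto_coeff_omegaPartial η k)) ?_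
  simp only [omegaPartial_succ_eq hη, sub_mul, map_sub, coeff_C_mul]
  refine Tendsto.sub ?_ ((htw k).const_mul _)
  cases k with
  | zero => simp
  | succ k => simpa only [coeff_succ_X_mul] using htw k

/-! ### Artin-Schreier equations -/

instance : IsAlgClosed (KinfBar Fq) := IsAlgClosure.isAlgClosed (Kinf Fq)

/-- The series ∑ y^{q^i} converges and telescopes. -/
theorem exists_sub_pow_eq_of_norm_lt {y : Cinf Fq} (hy : ‖y‖ < 1) :
    ∃ a : Cinf Fq, a - a ^ Fintype.card Fq = y ∧ ‖a‖ ≤ ‖y‖ := by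
  have hle : ∀ i : ℕ, ‖y ^ Fintype.card Fq ^ i‖ ≤ ‖y‖ := fun i => by
    rw [norm_pow]
    exact pow_le_of_le_one (norm_nonneg _) hy.le (pow_ne_zero _ Fintype.card_ne_zero)
  have hs : Summable fun i : ℕ => y ^ Fintype.card Fq ^ i := by
    refine NonarchimedeanAddGroup.summable_of_tendsto_cofinite_zero ?_
    rw [Nat.cofinite_eq_atTop]
    refine squeeze_zero_norm (fun i => ?_)
      (tendsto_pow_atTop_nhds_zero_of_lt_one (norm_nonneg y) hy)
    rw [norm_pow]
    exact pow_le_pow_of_le_one (norm_nonneg _) hy.le (Nat.lt_pow_self Fintype.one_lt_card).le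
  refine ⟨∑' i : ℕ, y ^ Fintype.card Fq ^ i, ?_,
    IsUltrametricDist.norm_tsum_le_of_forall_le hle⟩
  have hφ := hs.hasSum.map (FiniteField.frobeniusAlgHom Fq (Cinf Fq)) (by
    change Continuous fun x : Cinf Fq => x ^ Fintype.card Fq
    exact continuous_pow _)
  simp only [FiniteField.coe_frobeniusAlgHom, Function.comp_def, ← pow_mul, ← pow_succ] at hφ
  nth_rewrite 1 [hs.tsum_eq_zero_add]
  rw [hφ.tsum_eq]
  simp

/-- An approximation b of y in the dense algebraic closure is handled by a root of a polynomial, and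
the error y - b by the convergent series; algebraic closedness of ℂ_∞ itself is not needed. -/
theorem exists_sub_pow_eq (y : Cinf Fq) : ∃ a : Cinf Fq, a - a ^ Fintype.card Fq = y := by
  let ι : KinfBar Fq →+* Cinf Fq := UniformSpace.Completion.coeRingHom
  have hdense : DenseRange ι := UniformSpace.Completion.denseRange_coe
  obtain ⟨b, hb⟩ := hdense.exists_dist_lt y one_pos
  rw [dist_eq_norm] at hb
  obtain ⟨c, hc⟩ : ∃ c : KinfBar Fq, c - c ^ Fintype.card Fq = b := by
    have hq : 1 < Fintype.card Fq := Fintype.one_lt_card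
    have hdeg : (Polynomial.X ^ Fintype.card Fq - Polynomial.X + Polynomial.C b :
        Polynomial (KinfBar Fq)).degree = Fintype.card Fq := by
      rw [Polynomial.degree_add_eq_left_of_degree_lt, Polynomial.degree_sub_eq_left_of_degree_lt,
        Polynomial.degree_X_pow]
      · rw [Polynomial.degree_X_pow, Polynomial.degree_X]
        exact_mod_cast hq
      · rw [Polynomial.degree_sub_eq_left_of_degree_lt, Polynomial.degree_X_pow]
        · exact Polynomial.degree_C_le.trans_lt (by exact_mod_cast zero_lt_one.trans hq)
        · rw [Polynomial.degree_X_pow, Polynomial.degree_X]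
          exact_mod_cast hq
    obtain ⟨c, hc⟩ := IsAlgClosed.exists_root _ (by
      rw [hdeg]
      exact_mod_cast (zero_lt_one.trans hq).ne')
    refine ⟨c, ?_⟩
    simp only [Polynomial.IsRoot, Polynomial.eval_add, Polynomial.eval_sub, Polynomial.eval_pow,
      Polynomial.eval_X, Polynomial.eval_C] at hc
    linear_combination -hc
  obtain ⟨a, ha, -⟩ := exists_sub_pow_eq_of_norm_lt (y := y - ι b) hb
  refine ⟨a + ι c, ?_⟩
  have hadd : (a + ι c) ^ Fintype.card Fq = a ^ Fintype.card Fq + ι c ^ Fintype.card Fq :=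
    map_add (FiniteField.frobeniusAlgHom Fq (Cinf Fq)) a (ι c)
  have hι : ι c - ι c ^ Fintype.card Fq = ι b := by rw [← hc, map_sub, map_pow]
  rw [hadd]
  linear_combination ha + hι

/-- For 0 < |a| < 1 the term a^q is strictly smaller than a, so y must account for the size of a. -/
theorem norm_le_of_sub_pow_eq {a y : Cinf Fq} (ha : ‖a‖ < 1) (h : a - a ^ Fintype.card Fq = y) :
    ‖a‖ ≤ ‖y‖ := by
  by_contra! hlt
  have hpos : 0 < ‖a‖ := (norm_nonneg y).trans_lt hlt
  have hq : ‖a ^ Fintype.card Fq‖ < ‖a‖ := by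
    rw [norm_pow]
    exact pow_lt_self_of_lt_one₀ hpos ha Fintype.one_lt_card
  have := IsUltrametricDist.norm_add_le_max y (a ^ Fintype.card Fq)
  rw [← h, sub_add_cancel, h] at this
  exact (max_lt hlt hq).not_ge this

/-- The equation decouples into one Artin-Schreier equation per coefficient. Choosing the small root
whenever |y| < 1 makes the coefficients of g tend to 0. -/
theorem exists_isLi0Value {Y : (Cinf Fq)⟦X⟧} (hY : IsRestricted 1 Y) :
    ∃ g : Tate Fq, IsLi0Value Y g := by
  have hex : ∀ y : Cinf Fq, ∃ a : Cinf Fq,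
      a - a ^ Fintype.card Fq = y ∧ (‖y‖ < 1 → ‖a‖ ≤ ‖y‖) := by
    intro y
    by_cases hy : ‖y‖ < 1
    · obtain ⟨a, ha, ha'⟩ := exists_sub_pow_eq_of_norm_lt hy
      exact ⟨a, ha, fun _ => ha'⟩
    · obtain ⟨a, ha⟩ := exists_sub_pow_eq y
      exact ⟨a, ha, fun h => absurd h hy⟩
  choose s hs hs' using hex
  rw [isRestricted_iff'] at hY
  simp only [one_pow, mul_one] at hY
  refine ⟨⟨PowerSeries.mk fun k => s (coeff k Y), ?_⟩, ?_⟩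
  · change IsRestricted 1 _
    rw [isRestricted_iff']
    simp only [one_pow, mul_one, coeff_mk]
    refine squeeze_zero' (Eventually.of_forall fun k => norm_nonneg _) ?_ hY
    filter_upwards [hY.eventually_lt_const one_pos] with k hk
    exact hs' _ hk
  · ext k
    simpa [twist] using hs (coeff k Y)

/-- Membership of g in 𝕋 makes almost all its coefficients smaller than 1, hence dominated by those
of Y; every solution in 𝕋 inherits the convergence of Y. -/
theorem IsLi0Value.isRestricted {Y : (Cinf Fq)⟦X⟧} {g : Tate Fq} (h : IsLi0Value Y g) {r : ℝ}
    (hr : 0 ≤ r) (hY : IsRestricted r Y) : IsRestricted r (g : (Cinf Fq)⟦X⟧) := by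
  have hg : IsRestricted 1 (g : (Cinf Fq)⟦X⟧) := g.2
  rw [isRestricted_iff'] at hg hY ⊢
  simp only [one_pow, mul_one] at hg
  refine squeeze_zero' (Eventually.of_forall fun k => by positivity) ?_ hY
  filter_upwards [hg.eventually_lt_const one_pos] with k hk
  refine mul_le_mul_of_nonneg_right (norm_le_of_sub_pow_eq hk ?_) (by positivity)
  have := congrArg (coeff k) h
  simpa [twist] using this

/-! ### Branches of the continued polylogarithm -/

theorem ne_zero_of_pow_eq_neg_theta {η : Cinf Fq}
    (hη : η ^ (Fintype.card Fq - 1) = -theta Fq) : η ≠ 0 := by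
  rintro rfl
  rw [zero_pow (Nat.sub_ne_zero_of_lt Fintype.one_lt_card)] at hη
  exact norm_pos_iff.1 (one_pos.trans_le one_le_norm_theta) (neg_eq_zero.1 hη.symm)

theorem isRestricted_one_of_card {f : (Cinf Fq)⟦X⟧}
    (hf : IsRestricted (Fintype.card Fq : ℝ) f) : IsRestricted 1 f :=
  IsRestricted.mono zero_le_one (one_lt_card_real Fq).le hf

/-- The values of the polylogarithm are the solutions of a linear difference equation. -/
theorem isLiValue_iff {η : Cinf Fq} (hη : η ^ (Fintype.card Fq - 1) = -theta Fq) {n : ℕ}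
    {Z f : Tate Fq} : IsLiValue η n Z f ↔
      twist Fq f = (X - C (thetaConj Fq 1)) ^ n * ((f : (Cinf Fq)⟦X⟧) - (Z : (Cinf Fq)⟦X⟧)) := by
  have hη0 := ne_zero_of_pow_eq_neg_theta hη
  have hΩ : Omega η ^ n = (X - C (thetaConj Fq 1)) ^ n * twist Fq (Omega η) ^ n := by
    rw [← mul_pow, ← Omega_eq hη]
  have hΩ0 : twist Fq (Omega η) ^ n ≠ 0 := by
    refine pow_ne_zero _ fun h => Omega_ne_zero hη0 ?_
    rw [Omega_eq hη, h, mul_zero]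
  have hinv := Omega_pow_mul_inv_pow hη0 n
  constructor
  · rintro ⟨g, hg, hf⟩
    have hgf : (g : (Cinf Fq)⟦X⟧) = Omega η ^ n * f := by
      rw [hf, ← mul_assoc, hinv, one_mul]
    rw [IsLi0Value, hgf, map_mul, map_pow] at hg
    refine mul_left_cancel₀ hΩ0 ?_
    linear_combination (exp := 1) -hg + ((f : (Cinf Fq)⟦X⟧) - (Z : (Cinf Fq)⟦X⟧)) * hΩ
  · intro h
    refine ⟨⟨Omega η ^ n * f, ?_⟩, ?_, ?_⟩
    · exact isRestricted.mul 1 (IsRestricted.pow (isRestricted_one_of_card (isRestricted_Omega η)) n)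
        f.2
    · rw [IsLi0Value]
      simp only
      rw [map_mul, map_pow, h]
      linear_combination ((f : (Cinf Fq)⟦X⟧) - (Z : (Cinf Fq)⟦X⟧)) * hΩ
    · simp only
      rw [← mul_assoc, mul_comm ((Omega η)⁻¹ ^ n), hinv, one_mul]

theorem exists_isLiValue {η : Cinf Fq} (hη : η ≠ 0) (n : ℕ) (Z : Tate Fq) :
    ∃ f : Tate Fq, IsLiValue η n Z f := by
  obtain ⟨g, hg⟩ := exists_isLi0Value (Y := Omega η ^ n * (Z : (Cinf Fq)⟦X⟧))
    (isRestricted.mul 1 (IsRestricted.pow (isRestricted_one_of_card (isRestricted_Omega η)) n) Z.2)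
  exact ⟨⟨(Omega η)⁻¹ ^ n * g, isRestricted.mul 1
    (IsRestricted.pow (isRestricted_one_of_card (isRestricted_inv_Omega hη)) n) g.2⟩, g, hg, rfl⟩

theorem IsLiValue.isRestricted {η : Cinf Fq} (hη : η ≠ 0) {n : ℕ} {Z f : Tate Fq}
    (h : IsLiValue η n Z f) (hZ : IsRestricted (Fintype.card Fq : ℝ) (Z : (Cinf Fq)⟦X⟧)) :
    IsRestricted (Fintype.card Fq : ℝ) (f : (Cinf Fq)⟦X⟧) := by
  obtain ⟨g, hg, hf⟩ := h
  rw [hf]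
  exact isRestricted.mul _ (IsRestricted.pow (isRestricted_inv_Omega hη) n)
    (hg.isRestricted (by positivity) (isRestricted.mul _ (IsRestricted.pow (isRestricted_Omega η) n) hZ))

theorem twist_smul (c : Fq) (f : (Cinf Fq)⟦X⟧) : twist Fq (c • f) = c • twist Fq f := by
  ext k
  simp [twist, Algebra.smul_def, PowerSeries.algebraMap_apply]

/-- The pairs (Z, f) with f a value at Z form an 𝔽_q-subspace projecting onto the first factor; a
linear section of this projection is a branch. -/
theorem nonempty_liBranch {η : Cinf Fq} (hη : η ^ (Fintype.card Fq - 1) = -theta Fq) (n : ℕ) :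
    Nonempty (LiBranch η n) := by
  let V : Submodule Fq (Tate Fq × Tate Fq) :=
    { carrier := {p | IsLiValue η n p.1 p.2}
      zero_mem' := by
        simp only [Set.mem_ofPred_eq, isLiValue_iff hη]
        simp
      add_mem' := fun {p r} hp hr => by
        simp only [Set.mem_ofPred_eq, isLiValue_iff hη] at hp hr ⊢
        simp only [Prod.fst_add, Prod.snd_add, Subalgebra.coe_add, map_add, hp, hr]
        ring
      smul_mem' := fun c p hp => by
        simp only [Set.mem_ofPred_eq, isLiValue_iff hη] at hp ⊢
        simp only [Prod.smul_fst, Prod.smul_snd, Subalgebra.coe_smul, twist_smul, hp,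
          ← smul_sub, mul_smul_comm] }
  have hsurj : Function.Surjective ((LinearMap.fst Fq (Tate Fq) (Tate Fq)).comp V.subtype) := by
    intro Z
    obtain ⟨f, hf⟩ := exists_isLiValue (ne_zero_of_pow_eq_neg_theta hη) n Z
    exact ⟨⟨(Z, f), hf⟩, rfl⟩
  obtain ⟨s, hs⟩ := LinearMap.exists_rightInverse_of_surjective _ (LinearMap.range_eq_top.2 hsurj)
  refine ⟨⟨(LinearMap.snd Fq (Tate Fq) (Tate Fq)).comp (V.subtype.comp s), fun Z => ?_⟩⟩
  have h : IsLiValue η n (s Z : Tate Fq × Tate Fq).1 (s Z : Tate Fq × Tate Fq).2 := (s Z).2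
  have hZ : (s Z : Tate Fq × Tate Fq).1 = Z := LinearMap.congr_fun hs Z
  rwa [hZ] at h

/-! ### The indeterminacy of the polylogarithm -/

variable (Fq) in
/-- The indeterminacy `Ω^{-n} 𝔽_q[t]` of the polylogarithm, as the space of solutions of the
homogeneous difference equation. -/
def periodSeries (n : ℕ) : AddSubgroup (Cinf Fq)⟦X⟧ where
  carrier := {f | IsRestricted (Fintype.card Fq : ℝ) f ∧
    twist Fq f = (X - C (thetaConj Fq 1)) ^ n * f}
  zero_mem' := ⟨isRestricted_zero _, by simp⟩
  add_mem' hf hg := ⟨isRestricted.add _ hf.1 hg.1, by rw [map_add, hf.2, hg.2, mul_add]⟩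
  neg_mem' hf := ⟨isRestricted.neg _ hf.1, by rw [map_neg, hf.2, mul_neg]⟩

theorem X_mul_mem_periodSeries {n : ℕ} {f : (Cinf Fq)⟦X⟧} (hf : f ∈ periodSeries Fq n) :
    X * f ∈ periodSeries Fq n := by
  refine ⟨isRestricted.mul _ (isRestricted_X _) hf.1, ?_⟩
  rw [map_mul, hf.2, show twist Fq X = X by simp [twist]]
  ring

/-- The difference is a value at 0, which lies in 𝕋_q, so it converges on |t| ≤ q even when f and g
do not. -/
theorem sub_mem_periodSeries {η : Cinf Fq} (hη : η ^ (Fintype.card Fq - 1) = -theta Fq) {n : ℕ}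
    {Z f g : Tate Fq} (hf : IsLiValue η n Z f) (hg : IsLiValue η n Z g) :
    ((f : (Cinf Fq)⟦X⟧) - (g : (Cinf Fq)⟦X⟧)) ∈ periodSeries Fq n := by
  rw [isLiValue_iff hη] at hf hg
  have h : twist Fq ((f : (Cinf Fq)⟦X⟧) - (g : (Cinf Fq)⟦X⟧)) =
      (X - C (thetaConj Fq 1)) ^ n * ((f : (Cinf Fq)⟦X⟧) - (g : (Cinf Fq)⟦X⟧)) := by
    rw [map_sub, hf, hg]
    ring
  have hz : IsLiValue η n 0 (f - g) := by
    rw [isLiValue_iff hη]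
    simpa using h
  refine ⟨?_, h⟩
  simpa using hz.isRestricted (ne_zero_of_pow_eq_neg_theta hη)
    (by simpa using isRestricted_zero (R := Cinf Fq) (Fintype.card Fq : ℝ))

theorem mk_delta_eq {n : ℕ} (hn : 1 ≤ n) {f g : (Cinf Fq)⟦X⟧}
    (hg : IsRestricted (Fintype.card Fq : ℝ) g) (h : f - g ∈ periodSeries Fq n) :
    (QuotientAddGroup.mk (delta n f) : (Fin n → Cinf Fq) ⧸ Lambda Fq n) =
      QuotientAddGroup.mk (delta n g) := by
  rw [eq_comm, QuotientAddGroup.eq]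
  have := delta_add n hg h.1
  rw [add_sub_cancel] at this
  rw [this, neg_add_cancel_left]
  exact delta_mem_Lambda hn h.1 h.2

theorem delta_sum (n : ℕ) {ι : Type*} (s : Finset ι) (f : ι → (Cinf Fq)⟦X⟧)
    (hf : ∀ i, IsRestricted (Fintype.card Fq : ℝ) (f i)) :
    delta n (∑ i ∈ s, f i) = ∑ i ∈ s, delta n (f i) := by
  classical
  induction s using Finset.induction_on with
  | empty =>
    funext a
    simp [delta, thetaCoeff]
  | insert i s hi ih =>
    rw [Finset.sum_insert hi, Finset.sum_insert hi, delta_add n (hf i)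
      ((IsRestricted.subring (Fintype.card Fq : ℝ)).sum_mem fun j _ => hf j), ih]

/-- `t - θ`, as an element of `𝕋`. -/
abbrev varSubTheta (Fq : Type*) [Field Fq] [Fintype Fq] : Tate Fq :=
  varT Fq - constT Fq (theta Fq)

theorem coe_varT : (varT Fq : (Cinf Fq)⟦X⟧) = X := rfl

theorem coe_constT (z : Cinf Fq) : (constT Fq z : (Cinf Fq)⟦X⟧) = C z := rfl

theorem constT_add (y z : Cinf Fq) : constT Fq (y + z) = constT Fq y + constT Fq z :=
  Subtype.ext (map_add C y z)

theorem constT_mul (y z : Cinf Fq) : constT Fq (y * z) = constT Fq y * constT Fq z :=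
  Subtype.ext (map_mul C y z)

theorem isRestricted_varSubTheta_pow_mul {Z : Tate Fq}
    (hZ : IsRestricted (Fintype.card Fq : ℝ) (Z : (Cinf Fq)⟦X⟧)) (i : ℕ) :
    IsRestricted (Fintype.card Fq : ℝ) ((varSubTheta Fq ^ i * Z : Tate Fq) : (Cinf Fq)⟦X⟧) :=
  isRestricted.mul _ (IsRestricted.pow (isRestricted_X_sub_C _ _) i) hZ

theorem isLiValue_varT_mul {η : Cinf Fq} (hη : η ^ (Fintype.card Fq - 1) = -theta Fq) {n : ℕ}
    {Z f : Tate Fq} (hf : IsLiValue η n Z f) : IsLiValue η n (varT Fq * Z) (varT Fq * f) := by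
  rw [isLiValue_iff hη] at hf ⊢
  rw [Subalgebra.coe_mul, Subalgebra.coe_mul, map_mul, hf, coe_varT,
    show twist Fq X = X by simp [twist]]
  ring

/-- The twist of (t - θ)^n z is (t - θ^q)^n z^q, so the difference equation has this explicit
solution. It accounts for the Eτ term of the functional equation. -/
theorem isLiValue_varSubTheta_pow {η : Cinf Fq} (hη : η ^ (Fintype.card Fq - 1) = -theta Fq)
    (n : ℕ) (z : Cinf Fq) :
    IsLiValue η n (varSubTheta Fq ^ n * constT Fq z - constT Fq (z ^ Fintype.card Fq))
      (varSubTheta Fq ^ n * constT Fq z) := by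
  rw [isLiValue_iff hη]
  simp only [Subalgebra.coe_mul, Subalgebra.coe_sub, Subalgebra.coe_pow, coe_varT, coe_constT,
    map_mul, map_pow, twist_X_sub_C, twist_C]
  rw [← thetaConj_zero, ← map_pow C (thetaConj Fq 0), ← thetaConj_succ]
  ring

/-! ### The operator L on branches -/

namespace LiBranch

variable {η : Cinf Fq} {n : ℕ} (B : LiBranch η n)

theorem varT_mul_sub_mem (hη : η ^ (Fintype.card Fq - 1) = -theta Fq) (Z : Tate Fq) :
    (X * ((B.toLinearMap Z : Tate Fq) : (Cinf Fq)⟦X⟧) -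
      ((B.toLinearMap (varT Fq * Z) : Tate Fq) : (Cinf Fq)⟦X⟧)) ∈ periodSeries Fq n := by
  have h := sub_mem_periodSeries hη (isLiValue_varT_mul hη (B.isLift Z)) (B.isLift _)
  rwa [Subalgebra.coe_mul, coe_varT] at h

/-- Modulo the indeterminacy, `L` acts on the polylogarithm as multiplication of the argument
by `t - θ`. -/
theorem opL_iterate_sub_mem (hη : η ^ (Fintype.card Fq - 1) = -theta Fq) (i : ℕ) (Z : Tate Fq) :
    (((opL^[i] B.toLinearMap Z : Tate Fq) : (Cinf Fq)⟦X⟧) -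
      ((B.toLinearMap (varSubTheta Fq ^ i * Z) : Tate Fq) : (Cinf Fq)⟦X⟧)) ∈
      periodSeries Fq n := by
  induction i generalizing Z with
  | zero => simp
  | succ i ih =>
    rw [Function.iterate_succ_apply']
    have h1 := X_mul_mem_periodSeries (ih Z)
    have h2 := ih (constT Fq (theta Fq) * Z)
    -- A branch is only 𝔽_q-linear, so t is moved past it at the cost of a period, while θ has to
    -- stay in the argument.
    have h3 := B.varT_mul_sub_mem hη (varSubTheta Fq ^ i * Z)
    have h4 : varSubTheta Fq ^ (i + 1) * Z = varT Fq * (varSubTheta Fq ^ i * Z) -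
        varSubTheta Fq ^ i * (constT Fq (theta Fq) * Z) := by
      rw [pow_succ', varSubTheta]
      ring
    rw [h4, map_sub]
    convert (periodSeries Fq n).add_mem ((periodSeries Fq n).sub_mem h1 h2) h3 using 1
    rw [opL, Subalgebra.coe_sub, Subalgebra.coe_sub, Subalgebra.coe_mul, coe_varT]
    ring

theorem isRestricted_apply (hη : η ^ (Fintype.card Fq - 1) = -theta Fq) {Z : Tate Fq}
    (hZ : IsRestricted (Fintype.card Fq : ℝ) (Z : (Cinf Fq)⟦X⟧)) :
    IsRestricted (Fintype.card Fq : ℝ) (B.toLinearMap Z : (Cinf Fq)⟦X⟧) :=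
  (B.isLift Z).isRestricted (ne_zero_of_pow_eq_neg_theta hη) hZ

theorem isRestricted_opL_iterate (hη : η ^ (Fintype.card Fq - 1) = -theta Fq) (i : ℕ)
    {Z : Tate Fq} (hZ : IsRestricted (Fintype.card Fq : ℝ) (Z : (Cinf Fq)⟦X⟧)) :
    IsRestricted (Fintype.card Fq : ℝ) (opL^[i] B.toLinearMap Z : (Cinf Fq)⟦X⟧) := by
  have h := isRestricted.add _ (B.opL_iterate_sub_mem hη i Z).1
    (B.isRestricted_apply hη (isRestricted_varSubTheta_pow_mul hZ i))
  rwa [sub_add_cancel] at h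

end LiBranch

/-! ### The continued logarithm and its functional equation -/

/-- The element `∑_{k=1}^n (t - θ)^{n-k} z_k` of `𝕋`. -/
def thetaPoly {n : ℕ} (z : Fin n → Cinf Fq) : Tate Fq :=
  ∑ k : Fin n, varSubTheta Fq ^ (n - 1 - (k : ℕ)) * constT Fq (z k)

theorem isRestricted_constT (z : Cinf Fq) :
    IsRestricted (Fintype.card Fq : ℝ) (constT Fq z : (Cinf Fq)⟦X⟧) :=
  isRestricted_C _ z

theorem isRestricted_thetaPoly {n : ℕ} (z : Fin n → Cinf Fq) :
    IsRestricted (Fintype.card Fq : ℝ) (thetaPoly z : (Cinf Fq)⟦X⟧) := by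
  rw [thetaPoly, AddSubmonoidClass.coe_finsetSum]
  exact (IsRestricted.subring (Fintype.card Fq : ℝ)).sum_mem fun k _ =>
    isRestricted_varSubTheta_pow_mul (isRestricted_constT (z k)) _

theorem logOfBranch_eq {η : Cinf Fq} (hη : η ^ (Fintype.card Fq - 1) = -theta Fq) {n : ℕ}
    (hn : 1 ≤ n) (B : LiBranch η n) (z : Fin n → Cinf Fq) :
    logOfBranch B z = QuotientAddGroup.mk (delta n (B.toLinearMap (thetaPoly z))) := by
  rw [logOfBranch, thetaPoly, map_sum, AddSubmonoidClass.coe_finsetSum, ← delta_sum n _ _ fun k =>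
    B.isRestricted_opL_iterate hη _ (isRestricted_constT (z k))]
  refine mk_delta_eq hn ?_ ?_
  · exact (IsRestricted.subring (Fintype.card Fq : ℝ)).sum_mem fun k _ =>
      B.isRestricted_apply hη (isRestricted_varSubTheta_pow_mul (isRestricted_constT (z k)) _)
  · rw [← Finset.sum_sub_distrib]
    exact (periodSeries Fq n).sum_mem fun k _ => B.opL_iterate_sub_mem hη _ _

theorem vecLog_eq {η : Cinf Fq} (hη : η ^ (Fintype.card Fq - 1) = -theta Fq) {n : ℕ}
    (hn : 1 ≤ n) (B : LiBranch η n) (z : Fin n → Cinf Fq) :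
    vecLog η n z = QuotientAddGroup.mk (delta n (B.toLinearMap (thetaPoly z))) := by
  rw [vecLog, dif_pos ⟨B⟩, logOfBranch_eq hη hn]
  exact mk_delta_eq hn (B.isRestricted_apply hη (isRestricted_thetaPoly z))
    (sub_mem_periodSeries hη (LiBranch.isLift _ _) (B.isLift _))

/-- In powers of t - θ, multiplication by t acts as θI + N except that the top term overflows to (t
- θ)^n z_1; the action ρₙ(t) has z_1^q in the constant term instead. -/
theorem thetaPoly_rhoT {n : ℕ} (hn : 1 ≤ n) (z : Fin n → Cinf Fq) :
    thetaPoly (rhoT n z) = varT Fq * thetaPoly z -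
      (varSubTheta Fq ^ n * constT Fq (z ⟨0, hn⟩) -
        constT Fq (z ⟨0, hn⟩ ^ Fintype.card Fq)) := by
  obtain ⟨m, rfl⟩ := Nat.exists_eq_add_of_le' hn
  have hρ : ∀ k : Fin (m + 1), rhoT (m + 1) z k = theta Fq * z k +
      if h : (k : ℕ) + 1 < m + 1 then z ⟨k + 1, h⟩ else z 0 ^ Fintype.card Fq := by
    intro k
    rw [rhoT, Pi.add_apply, matD_mulVec_apply, matE_mulVec_apply, add_assoc]
    congr 1
    split_ifs with h1 h2 h2
    · omega
    · rw [add_zero]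
    · simp [frobVec]
    · omega
  have hX : varT Fq * thetaPoly z =
      constT Fq (theta Fq) * thetaPoly z + varSubTheta Fq * thetaPoly z := by
    rw [varSubTheta]
    ring
  rw [hX]
  have h1 : varSubTheta Fq * thetaPoly z = varSubTheta Fq ^ (m + 1) * constT Fq (z 0) +
      ∑ j : Fin m, varSubTheta Fq ^ (m - (j : ℕ)) * constT Fq (z j.succ) := by
    rw [thetaPoly, Fin.sum_univ_succ, mul_add, Finset.mul_sum]
    congr 1
    · simp only [Fin.val_zero, add_tsub_cancel_right, tsub_zero]
      ring
    · refine Finset.sum_congr rfl fun j _ => ?_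
      rw [← mul_assoc, ← pow_succ']
      congr 2
      simp only [Fin.val_succ]
      omega
  have h2 : thetaPoly (rhoT (m + 1) z) = constT Fq (theta Fq) * thetaPoly z +
      ((∑ j : Fin m, varSubTheta Fq ^ (m - (j : ℕ)) * constT Fq (z j.succ)) +
        constT Fq (z 0 ^ Fintype.card Fq)) := by
    rw [thetaPoly]
    simp only [hρ, constT_add, constT_mul, mul_add, Finset.sum_add_distrib]
    congr 1
    · rw [thetaPoly, Finset.mul_sum]
      exact Finset.sum_congr rfl fun k _ => by ring
    · rw [Fin.sum_univ_castSucc]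
      congr 1
      · refine Finset.sum_congr rfl fun j _ => ?_
        rw [dif_pos (by simp)]
        rfl
      · rw [dif_neg (by simp)]
        simp
  rw [h2, h1]
  change _ = _ - (_ * constT Fq (z 0) - constT Fq (z 0 ^ _))
  ring

theorem vecLog_rhoT {η : Cinf Fq} (hη : η ^ (Fintype.card Fq - 1) = -theta Fq) {n : ℕ}
    (hn : 1 ≤ n) (z : Fin n → Cinf Fq) :
    vecLog η n (rhoT n z) = dRhoQuot n (vecLog η n z) := by
  obtain ⟨B⟩ := nonempty_liBranch hη n
  rw [vecLog_eq hη hn B, vecLog_eq hη hn B]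
  change _ = (QuotientAddGroup.mk (matD n *ᵥ delta n (B.toLinearMap (thetaPoly z))) :
    (Fin n → Cinf Fq) ⧸ Lambda Fq n)
  set y := z ⟨0, hn⟩ with hy
  set f : (Cinf Fq)⟦X⟧ := ((B.toLinearMap (thetaPoly z) : Tate Fq) : (Cinf Fq)⟦X⟧) with hf
  have hfr : IsRestricted (Fintype.card Fq : ℝ) f :=
    B.isRestricted_apply hη (isRestricted_thetaPoly z)
  have hXf := isRestricted.mul (Fintype.card Fq : ℝ) (isRestricted_X _) hfr
  -- The correction p is invisible to `delta`, and adding it makes the two series differ by a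
  -- period.
  set p : (Cinf Fq)⟦X⟧ := (X - C (theta Fq)) ^ n * C (-y) with hp
  have hpr : IsRestricted (Fintype.card Fq : ℝ) p :=
    isRestricted.mul _ (IsRestricted.pow (isRestricted_X_sub_C _ _) n) (isRestricted_C _ _)
  have hD : matD n *ᵥ delta n f = delta n (X * f + p) := by
    rw [delta_add n hXf hpr, delta_X_mul n hfr,
      delta_X_sub_C_pow_mul n (isRestricted_C _ _), add_zero]
  rw [hD]
  refine mk_delta_eq hn (isRestricted.add _ hXf hpr) ?_
  rw [thetaPoly_rhoT hn, map_sub]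
  have h1 := B.varT_mul_sub_mem hη (thetaPoly z)
  have h2 := sub_mem_periodSeries hη (isLiValue_varSubTheta_pow hη n y) (B.isLift _)
  convert (periodSeries Fq n).sub_mem h2 h1 using 1
  simp only [Subalgebra.coe_sub, Subalgebra.coe_mul, Subalgebra.coe_pow, coe_varT, coe_constT]
  rw [hp, map_neg]
  ring

end CarlitzLog

end

theorem mainTheorem9 (Fq : Type*) [Field Fq] [Fintype Fq]
    (η : CarlitzLog.Cinf Fq) (hη : η ^ (Fintype.card Fq - 1) = -CarlitzLog.theta Fq)
    (n : ℕ) (hn : 1 ≤ n) :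
    -- branches exist, and the continued logarithm does not depend on the branch
    Nonempty (CarlitzLog.LiBranch η n) ∧
    (∀ B : CarlitzLog.LiBranch η n,
      (∀ (i : ℕ) (z : CarlitzLog.Cinf Fq),
        PowerSeries.IsRestricted (Fintype.card Fq : ℝ)
          ((CarlitzLog.opL^[i] B.toLinearMap (CarlitzLog.constT Fq z) : CarlitzLog.Tate Fq) :
            PowerSeries (CarlitzLog.Cinf Fq))) ∧
      (∀ z, CarlitzLog.vecLog η n z = CarlitzLog.logOfBranch B z) ∧
      (∀ z, CarlitzLog.vecLog η n z = QuotientAddGroup.mk (CarlitzLog.delta n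
        (B.toLinearMap (∑ k : Fin n,
          (CarlitzLog.varT Fq - CarlitzLog.constT Fq (CarlitzLog.theta Fq)) ^ (n - 1 - (k : ℕ)) *
            CarlitzLog.constT Fq (z k)))))) ∧
    -- the functional equation
    ∀ z : Fin n → CarlitzLog.Cinf Fq,
      CarlitzLog.vecLog η n (CarlitzLog.rhoT n z) =
        CarlitzLog.dRhoQuot n (CarlitzLog.vecLog η n z) := by
  have hlog := fun B => CarlitzLog.vecLog_eq hη hn (B := B)
  refine ⟨CarlitzLog.nonempty_liBranch hη n, fun B => ⟨fun i z => ?_, fun z => ?_, hlog B⟩,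
    CarlitzLog.vecLog_rhoT hη hn⟩
  · exact B.isRestricted_opL_iterate hη i (CarlitzLog.isRestricted_constT z)
  · rw [hlog B, CarlitzLog.logOfBranch_eq hη hn]
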